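/- Let $D$ and $G$ be domains (nonempty connected open sets) in $\mathbb C^n$ and let $\pi:D\to G$ be a proper holomorphic map, that is, $\pi$ is holomorphic and $\pi^{-1}(K)$ is compact for every compact $K\subset G$. Put $\mathcal J_\pi=\{z\in D:\det\pi'(z)=0\}$ (the locus set), and assume that $\pi$ is $2$-proper, i.e. has multiplicity $2$: for every $w\in G\setminus\pi(\mathcal J_\pi)$ the fibre $\pi^{-1}(w)$ has exactly two points. Let $\mathrm{Aut}(D)$ be the group of biholomorphic self-maps of $D$ and let $\mathrm{Deck}(\pi)=\{\rho\in\mathrm{Aut}(D):\pi\circ\rho=\pi\}$. Then there is $g\in\mathrm{Aut}(D)$ such that: 1. $g\neq\mathrm{id}$, $g\circ g=\mathrm{id}$, and $g(z)=z$ for all $z\in\mathcal J_\pi$; 2. $\pi$ is Galois, i.e. $\mathrm{Deck}(\pi)$ acts transitively on $\pi^{-1}(w)$ for every $w\in G$; 3. $\mathrm{Deck}(\pi)=\{\mathrm{id},g\}$; 4. $D/\mathrm{Deck}(\pi)$ is biholomorphic to $G$, via the map induced by $\pi$. Here $D/\mathrm{Deck}(\pi)$ carries the quotient topology and the quotient complex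 structure, in which a function on an open subset is holomorphic if and only if its pull-back to $D$ is holomorphic. -/

import Mathlib

namespace ProperHol

/-- The space `ℂⁿ`. -/
abbrev Cn (n : ℕ) := EuclideanSpace ℂ (Fin n)

/-- A domain of `ℂⁿ`: a nonempty connected open set. -/
def IsDom {n : ℕ} (D : Set (Cn n)) : Prop :=
  IsOpen D ∧ IsConnected D

/-- `π : D → G` is a proper holomorphic map. The map is given by a function on `ℂⁿ`
of which only the values on `D` matter. -/
structure IsProperHolomorphic {n : ℕ} (D G : Set (Cn n)) (π : Cn n → Cn n) : Prop where
  mapsTo : Set.MapsTo π D G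
  holomorphic : DifferentiableOn ℂ π D
  isCompact_preimage : ∀ K : Set (Cn n), K ⊆ G → IsCompact K → IsCompact (D ∩ π ⁻¹' K)

/-- The locus set `J_π = {z ∈ D : det π'(z) = 0}`. -/
def locus {n : ℕ} (D : Set (Cn n)) (π : Cn n → Cn n) : Set (Cn n) :=
  {z | z ∈ D ∧ (fderiv ℂ π z).det = 0}

/-- `π : D → G` is an `m`-proper holomorphic map: it is proper and holomorphic, of multiplicity
`m`, i.e. the fibre over every regular value `w ∈ G \ π(J_π)` consists of exactly `m` points. -/
structure IsMProper {n : ℕ} (m : ℕ) (D G : Set (Cn n)) (π : Cn n → Cn n) : Prop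
    extends IsProperHolomorphic D G π where
  encard_fibre : ∀ w ∈ G \ π '' locus D π, (D ∩ π ⁻¹' {w}).encard = m

/-- A self-map of `D` is holomorphic. -/
def IsHolSelfMap {n : ℕ} {D : Set (Cn n)} (f : D → D) : Prop :=
  ∃ F : Cn n → Cn n, DifferentiableOn ℂ F D ∧ ∀ z : D, F z = f z

/-- The group `Aut(D)` of holomorphic automorphisms (biholomorphic self-maps) of `D`. -/
def Aut {n : ℕ} (D : Set (Cn n)) : Subgroup (Equiv.Perm D) where
  carrier := {ρ | IsHolSelfMap ρ ∧ IsHolSelfMap ρ.symm}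
  one_mem' := ⟨⟨id, differentiableOn_id, fun _ => rfl⟩, ⟨id, differentiableOn_id, fun _ => rfl⟩⟩
  mul_mem' := by
    rintro a b ⟨⟨A, hA, hA'⟩, ⟨A₁, hA₁, hA₁'⟩⟩ ⟨⟨B, hB, hB'⟩, ⟨B₁, hB₁, hB₁'⟩⟩
    refine ⟨⟨A ∘ B, hA.comp hB fun z hz => ?_, fun z => ?_⟩,
      ⟨B₁ ∘ A₁, hB₁.comp hA₁ fun z hz => ?_, fun z => ?_⟩⟩
    · rw [hB' ⟨z, hz⟩]; exact (b ⟨z, hz⟩).2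
    · change A (B z) = _
      rw [hB' z, hA' (b z)]; rfl
    · rw [hA₁' ⟨z, hz⟩]; exact (a.symm ⟨z, hz⟩).2
    · change B₁ (A₁ z) = _
      rw [hA₁' z, hB₁' (a.symm z)]; rfl
  inv_mem' := by
    rintro a ⟨h, h'⟩
    exact ⟨h', h⟩

/-- The group `Deck(π)` of deck automorphisms: the `ρ ∈ Aut(D)` with `π ∘ ρ = π` on `D`. -/
def Deck {n : ℕ} (D : Set (Cn n)) (π : Cn n → Cn n) : Subgroup (Aut D) where
  carrier := {ρ | ∀ z : D, π (ρ.1 z) = π z}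
  one_mem' := fun _ => rfl
  mul_mem' := by
    intro a b ha hb z
    exact (ha (b.1 z)).trans (hb z)
  inv_mem' := by
    intro a ha z
    have h := ha (a.1.symm z)
    rw [Equiv.apply_symm_apply] at h
    exact h.symm

/-- `π : D → G` is Galois: `Deck(π)` acts transitively on the fibre `π⁻¹(w)` for every `w ∈ G`. -/
def IsGaloisMap {n : ℕ} (D G : Set (Cn n)) (π : Cn n → Cn n) : Prop :=
  ∀ w ∈ G, ∀ z z' : D, π z = w → π z' = w → ∃ ρ ∈ Deck D π, ρ.1 z = z'

/-- The orbit space `D/Γ` of a group `Γ` of automorphisms of `D`; it carries the quotient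
topology. -/
abbrev OrbitSpace {n : ℕ} {D : Set (Cn n)} (Γ : Subgroup (Aut D)) : Type :=
  MulAction.orbitRel.Quotient Γ D

/-- The projection `D → D/Γ`. -/
def OrbitSpace.proj {n : ℕ} {D : Set (Cn n)} (Γ : Subgroup (Aut D)) : D → OrbitSpace Γ :=
  Quotient.mk (MulAction.orbitRel Γ D)

/-- The structure sheaf of an open set `G ⊆ ℂⁿ`: `f` is a holomorphic function on the open
subset `W` of `G` (the values of `f` off `W` are irrelevant). -/
def IsHolFunOn {n : ℕ} (G : Set (Cn n)) (W : Set G) (f : G → ℂ) : Prop :=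
  ∃ F : Cn n → ℂ, DifferentiableOn ℂ F (Subtype.val '' W) ∧ ∀ z ∈ W, F z = f z

/-- The structure sheaf of the quotient complex space `D/Γ`: a function on an open subset `W` of
`D/Γ` is holomorphic if its pull-back to `D` is a holomorphic function on the preimage of `W`. -/
def OrbitSpace.IsHolFunOn {n : ℕ} {D : Set (Cn n)} (Γ : Subgroup (Aut D)) (W : Set (OrbitSpace Γ))
    (f : OrbitSpace Γ → ℂ) : Prop :=
  ProperHol.IsHolFunOn D (OrbitSpace.proj Γ ⁻¹' W) (f ∘ OrbitSpace.proj Γ)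

/-- A homeomorphism `Φ : D/Γ → G` is biholomorphic if it is an isomorphism of complex spaces:
pull-back along `Φ` and `Φ⁻¹` identifies the holomorphic functions on an open set `W ⊆ G` with
those on `Φ⁻¹(W)`. -/
def OrbitSpace.IsBiholomorphism {n : ℕ} {D G : Set (Cn n)} {Γ : Subgroup (Aut D)}
    (Φ : OrbitSpace Γ ≃ₜ G) : Prop :=
  ∀ W : Set G, IsOpen W → ∀ f : G → ℂ,
    ProperHol.IsHolFunOn G W f ↔ OrbitSpace.IsHolFunOn Γ (Φ ⁻¹' W) (f ∘ Φ)

end ProperHol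

namespace ProperHol

open Set Metric Filter Topology MeasureTheory

/-! ### Holomorphic functions of several variables. -/

section SeveralVariables

variable {E F : Type*} [NormedAddCommGroup E] [NormedSpace ℂ E]
  [NormedAddCommGroup F] [NormedSpace ℂ F]

/-! Over a regular value the fibre is an unordered pair {a, b}. Symmetric functions of the pair are
single-valued, holomorphic and locally bounded, so they extend holomorphically to all of G. With σ
extending a + b, the map γ z = σ(π z) - z exchanges the two points at regular points, and by density
it is an involution of D over G. The extended products a_i b_j + a_j b_i show that every fibre is
{z, γ z} (`IsMProper.exists_isSheetInvolution`). Hence π is Galois, and the identity theorem leaves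
only id and γ in Deck(π). If γ moved a point of the locus, one sheet could be singled out near it
and would extend to a holomorphic left inverse of π there, against det π' = 0
(`IsSheetInvolution.eq_self_of_mem_locus`).

The analytic core is the extension across the critical values, done without knowing that they form
an analytic set. They are the zeros in G of a continuous δ = J(a) J(b), J = det π', which is
holomorphic off its zeros (`IsFibrePair.exists_defining_function`). Radó's theorem makes δ
holomorphic on complex lines, and averages over circles avoiding its zeros give a Riemann extension
theorem (`exists_extension_of_bounded_off_zeros`). Regular values are dense by the easy case of
Sard's theorem (`addHaar_image_locus`).

Finally, properness makes the induced bijection D/Deck(π) → G a homeomorphism, and the same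
extension theorem shows that functions with holomorphic pull-back are holomorphic. -/

theorem eqOn_zero_of_eventuallyEq_zero [CompleteSpace F] {U : Set E} (hU : IsOpen U)
    (hUc : IsPreconnected U) {f : E → F} (hf : DifferentiableOn ℂ f U) {z₀ : E} (hz₀ : z₀ ∈ U)
    (h : f =ᶠ[𝓝 z₀] 0) : EqOn f 0 U := by
  set S : Set E := {z | f =ᶠ[𝓝 z] 0}
  have hS : IsOpen S := by
    rw [isOpen_iff_eventually]
    exact fun z hz => eventually_eventually_nhds.2 hz
  have hsub : U ⊆ S := by
    refine hUc.subset_of_closure_inter_subset hS ⟨z₀, hz₀, h⟩ ?_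
    rintro z ⟨hzS, hzU⟩
    obtain ⟨r, hr, hrU⟩ := Metric.isOpen_iff.1 hU z hzU
    obtain ⟨z₁, hz₁, hz₁S⟩ := mem_closure_iff.1 hzS _ isOpen_ball (mem_ball_self hr)
    refine Filter.eventually_of_mem (ball_mem_nhds z hr) fun y hy => ?_
    -- The complex line through z₁ and y meets the ball in a convex set, so the one-variable
    -- identity theorem carries the vanishing from l = 0 to l = 1, which is y.
    set L : ℂ → E := fun l => z₁ + l • (y - z₁) with hL
    have hLd : Differentiable ℂ L := by fun_prop
    have hLo : IsOpen (L ⁻¹' ball z r) := isOpen_ball.preimage hLd.continuous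
    have hLc : IsPreconnected (L ⁻¹' ball z r) := by
      have : Convex ℝ (L ⁻¹' ball z r) := by
        intro a ha b hb s t hs ht hst
        have := (convex_ball z r) ha hb hs ht hst
        have h2 : L (s • a + t • b) = s • L a + t • L b := by
          obtain rfl : t = 1 - s := by linarith
          simp only [hL, ← Complex.coe_smul, Complex.ofReal_sub, Complex.ofReal_one]
          module
        rwa [mem_preimage, h2]
      exact this.isPreconnected
    have hfa : AnalyticOnNhd ℂ (f ∘ L) (L ⁻¹' ball z r) :=
      (((hf.mono hrU).comp hLd.differentiableOn (mapsTo_preimage _ _))).analyticOnNhd hLo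
    have h0 : (0 : ℂ) ∈ L ⁻¹' ball z r := by simpa [hL] using hz₁
    have h1 : (1 : ℂ) ∈ L ⁻¹' ball z r := by simpa [hL] using hy
    have hev : f ∘ L =ᶠ[𝓝 0] 0 := by
      have : Tendsto L (𝓝 0) (𝓝 z₁) := by
        simpa [hL] using hLd.continuous.tendsto 0
      exact this.eventually hz₁S
    simpa [hL] using hfa.eqOn_zero_of_preconnected_of_eventuallyEq_zero hLc h0 hev h1
  exact fun z hz => (hsub hz).self_of_nhds

variable [FiniteDimensional ℂ E]

/-- Cauchy's estimate for the difference of f and a small translate: it is bounded by ε r / 16 on a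
ball of radius r / 4, so its derivative at the centre is at most ε / 2. -/
theorem continuousOn_fderiv_of_differentiableOn {U : Set E} (hU : IsOpen U) {f : E → F}
    (hf : DifferentiableOn ℂ f U) : ContinuousOn (fderiv ℂ f) U := by
  have : ProperSpace E := FiniteDimensional.proper ℂ E
  intro z₀ hz₀
  apply ContinuousAt.continuousWithinAt
  obtain ⟨r, hr, hrU⟩ := Metric.isOpen_iff.1 hU z₀ hz₀
  have hK : IsCompact (closedBall z₀ (r / 2)) := isCompact_closedBall _ _
  have hKU : closedBall z₀ (r / 2) ⊆ U := (closedBall_subset_ball (by linarith)).trans hrU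
  have huc := hK.uniformContinuousOn_of_continuous (hf.continuousOn.mono hKU)
  rw [Metric.uniformContinuousOn_iff] at huc
  rw [Metric.continuousAt_iff]
  intro ε hε
  obtain ⟨δ, hδ, H⟩ := huc (ε * r / 16) (by positivity)
  refine ⟨min δ (r / 4), by positivity, fun {z} hz => ?_⟩
  have hzδ : dist z z₀ < δ := hz.trans_le (min_le_left _ _)
  have hzr : dist z z₀ < r / 4 := hz.trans_le (min_le_right _ _)
  have hsub : ∀ x ∈ ball z₀ (r / 4), x ∈ closedBall z₀ (r / 2) := fun x hx => by
    simp only [mem_ball, mem_closedBall] at hx ⊢; linarith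
  have hsub' : ∀ x ∈ ball z₀ (r / 4), x + (z - z₀) ∈ closedBall z₀ (r / 2) := fun x hx => by
    simp only [mem_ball, mem_closedBall, dist_eq_norm] at hx hzr ⊢
    calc ‖x + (z - z₀) - z₀‖ = ‖(x - z₀) + (z - z₀)‖ := by congr 1; abel
      _ ≤ ‖x - z₀‖ + ‖z - z₀‖ := norm_add_le _ _
      _ ≤ r / 2 := by linarith
  have hd : ∀ x ∈ closedBall z₀ (r / 2), DifferentiableAt ℂ f x := fun x hx =>
    hf.differentiableAt (hU.mem_nhds (hKU hx))
  set g : E → F := fun x => f (x + (z - z₀)) - f x with hg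
  have hgd : DifferentiableOn ℂ g (ball z₀ (r / 4)) := fun x hx =>
    (((hd _ (hsub' x hx)).comp x (by fun_prop : DifferentiableAt ℂ (fun y => y + (z - z₀)) x)).sub
      (hd _ (hsub x hx))).differentiableWithinAt
  have hgb : ∀ x ∈ ball z₀ (r / 4), ‖g x‖ ≤ ε * r / 16 := fun x hx => by
    have := H _ (hsub' x hx) _ (hsub x hx) (by rw [dist_eq_norm]; simpa [dist_eq_norm] using hzδ)
    rw [dist_eq_norm] at this
    exact this.le
  have hmaps : MapsTo g (ball z₀ (r / 4)) (closedBall (g z₀) (ε * r / 8)) := fun x hx => by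
    rw [mem_closedBall, dist_eq_norm]
    have h1 := hgb x hx
    have h2 := hgb z₀ (mem_ball_self (by positivity))
    linarith [norm_sub_le (g x) (g z₀)]
  have hb := Complex.norm_fderiv_le_div_of_mapsTo_ball hgd hmaps (by positivity)
  have hz0 : z₀ ∈ ball z₀ (r / 4) := mem_ball_self (by positivity)
  have hfg : fderiv ℂ g z₀ = fderiv ℂ f z - fderiv ℂ f z₀ := by
    have h1 : HasFDerivAt (fun y => f (y + (z - z₀))) (fderiv ℂ f z) z₀ := by
      have h3 : HasFDerivAt f (fderiv ℂ f z) (z₀ + (z - z₀)) := by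
        have := (hd _ (hsub' z₀ hz0)).hasFDerivAt
        simpa using this
      simpa [Function.comp_def] using h3.comp z₀ ((hasFDerivAt_id z₀).add_const (z - z₀))
    exact (h1.sub (hd _ (hsub z₀ hz0)).hasFDerivAt).fderiv
  rw [dist_eq_norm, ← hfg]
  refine hb.trans_lt ?_
  rw [div_lt_iff₀ (by positivity)]
  nlinarith

theorem contDiffOn_one_of_differentiableOn {U : Set E} (hU : IsOpen U) {f : E → F}
    (hf : DifferentiableOn ℂ f U) : ContDiffOn ℂ 1 f U := by
  rw [show (1 : WithTop ℕ∞) = 0 + 1 from rfl, contDiffOn_succ_iff_fderiv_of_isOpen hU]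
  exact ⟨hf, by simp, contDiffOn_zero.2 (continuousOn_fderiv_of_differentiableOn hU hf)⟩

/-- Differentiation under the integral sign for a family of translates of a holomorphic
function. -/
theorem differentiableAt_integral_translates {U : Set E} (hU : IsOpen U) {f : E → F}
    (hf : DifferentiableOn ℂ f U) {φ : ℝ → ℂ} (hφ : Continuous φ) {γ : ℝ → E} (hγ : Continuous γ)
    {a b : ℝ} {w₀ : E} (hw₀ : ∀ t, w₀ + γ t ∈ U) :
    DifferentiableAt ℂ (fun w => ∫ t in a..b, φ t • f (w + γ t)) w₀ := by
  have : ProperSpace E := FiniteDimensional.proper ℂ E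
  have hK : IsCompact ((fun t => w₀ + γ t) '' uIcc a b) :=
    isCompact_uIcc.image (by fun_prop)
  -- A compact thickening of the path inside U gives one bound on the derivative for all w near w₀,
  -- as dominated differentiation needs.
  obtain ⟨δ, hδ, hδU⟩ := hK.exists_cthickening_subset_open hU (by rintro _ ⟨t, -, rfl⟩; exact hw₀ t)
  have hC : IsCompact (cthickening δ ((fun t => w₀ + γ t) '' uIcc a b)) := hK.cthickening
  obtain ⟨M, hM⟩ := hC.exists_bound_of_continuousOn
    ((continuousOn_fderiv_of_differentiableOn hU hf).mono hδU)
  obtain ⟨A, hA⟩ := (isCompact_uIcc (a := a) (b := b)).exists_bound_of_continuousOn hφ.continuousOn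
  have hmem : ∀ t ∈ uIcc a b, ∀ w ∈ ball w₀ δ,
      w + γ t ∈ cthickening δ ((fun t => w₀ + γ t) '' uIcc a b) := fun t ht w hw => by
    refine mem_cthickening_of_dist_le _ _ _ _ (mem_image_of_mem _ ht) ?_
    simpa using (mem_ball.1 hw).le
  have hd : ∀ x ∈ U, DifferentiableAt ℂ f x := fun x hx => hf.differentiableAt (hU.mem_nhds hx)
  have hcont : ∀ w ∈ ball w₀ δ, ContinuousOn (fun t => φ t • f (w + γ t)) (uIcc a b) :=
    fun w hw => hφ.continuousOn.smul
      (hf.continuousOn.comp (by fun_prop) fun t ht => hδU (hmem t ht w hw))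
  have hw : w₀ ∈ ball w₀ δ := mem_ball_self hδ
  refine (intervalIntegral.hasFDerivAt_integral_of_dominated_of_fderiv_le (𝕜 := ℂ)
    (F := fun w t => φ t • f (w + γ t)) (F' := fun w t => φ t • fderiv ℂ f (w + γ t))
    (bound := fun _ => A * M) (s := ball w₀ δ) (ball_mem_nhds _ hδ) ?_ ?_ ?_ ?_ ?_ ?_).differentiableAt
  · filter_upwards [ball_mem_nhds w₀ hδ] with w hw
    exact ((hcont w hw).mono uIoc_subset_uIcc).aestronglyMeasurable measurableSet_uIoc
  · exact (hcont w₀ hw).intervalIntegrable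
  · refine ContinuousOn.aestronglyMeasurable ?_ measurableSet_uIoc
    exact hφ.continuousOn.smul ((continuousOn_fderiv_of_differentiableOn hU hf).comp
      (by fun_prop) fun t ht => hw₀ t)
  · refine Eventually.of_forall fun t ht w hw => ?_
    have ht := uIoc_subset_uIcc ht
    rw [norm_smul]
    exact mul_le_mul (hA t ht) (hM _ (hmem t ht w hw)) (norm_nonneg _)
      ((norm_nonneg _).trans (hA t ht))
  · exact _root_.intervalIntegrable_const
  · refine Eventually.of_forall fun t ht w hw => ?_
    have h := (hd _ (hδU (hmem t (uIoc_subset_uIcc ht) w hw))).hasFDerivAt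
    have h2 : HasFDerivAt (fun w => f (w + γ t)) (fderiv ℂ f (w + γ t)) w := by
      simpa [Function.comp_def] using h.comp w ((hasFDerivAt_id w).add_const (γ t))
    exact h2.const_smul (φ t)

/-- The directional derivative is a Cauchy integral over a circle in the line through z along v,
whose radius is fixed near z₀; that integral may be differentiated in z. -/
theorem differentiableOn_fderiv_apply [CompleteSpace F] {U : Set E} (hU : IsOpen U) {f : E → F}
    (hf : DifferentiableOn ℂ f U) (v : E) : DifferentiableOn ℂ (fun z => fderiv ℂ f z v) U := by
  intro z₀ hz₀
  apply DifferentiableAt.differentiableWithinAt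
  obtain ⟨r, hr, hrU⟩ := Metric.isOpen_iff.1 hU z₀ hz₀
  obtain ⟨s, hs, hsv⟩ : ∃ s : ℝ, 0 < s ∧ s * ‖v‖ < r / 2 := by
    refine ⟨r / (4 * (‖v‖ + 1)), by positivity, ?_⟩
    rw [div_mul_eq_mul_div, div_lt_iff₀ (by positivity)]
    nlinarith [norm_nonneg v]
  have hmem : ∀ z ∈ ball z₀ (r / 2), ∀ l ∈ closedBall (0 : ℂ) s, z + l • v ∈ U := by
    intro z hz l hl
    refine hrU ?_
    rw [mem_ball, dist_eq_norm] at *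
    have hl' : ‖l‖ ≤ s := by simpa using hl
    calc ‖z + l • v - z₀‖ = ‖(z - z₀) + l • v‖ := by congr 1; abel
      _ ≤ ‖z - z₀‖ + ‖l • v‖ := norm_add_le _ _
      _ ≤ ‖z - z₀‖ + s * ‖v‖ := by rw [norm_smul]; gcongr
      _ < r := by linarith
  have hd : ∀ x ∈ U, DifferentiableAt ℂ f x := fun x hx => hf.differentiableAt (hU.mem_nhds hx)
  have key : ∀ᶠ z in 𝓝 z₀, fderiv ℂ f z v = (2 * Real.pi * Complex.I : ℂ)⁻¹ •
      ∫ t in (0 : ℝ)..2 * Real.pi, (deriv (circleMap 0 s) t * ((circleMap 0 s t) ^ 2)⁻¹) •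
        f (z + circleMap 0 s t • v) := by
    filter_upwards [ball_mem_nhds z₀ (half_pos hr)] with z hz
    have h1 : ∀ l ∈ closedBall (0 : ℂ) s, HasDerivAt (fun l : ℂ => f (z + l • v))
        (fderiv ℂ f (z + l • v) v) l := fun l hl => by
      have h2 : HasDerivAt (fun l : ℂ => z + l • v) v l := by
        simpa using ((hasDerivAt_id l).smul_const v).const_add z
      exact (hd _ (hmem z hz l hl)).hasFDerivAt.comp_hasDerivAt l h2
    have hL : Continuous fun l : ℂ => z + l • v := by fun_prop
    have h2 := Complex.two_pi_I_inv_smul_circleIntegral_sub_sq_inv_smul_of_differentiable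
      (hU.preimage hL) (hmem z hz) (f := fun l : ℂ => f (z + l • v)) (hf.comp (by fun_prop)
        fun l hl => hl) (mem_ball_self hs)
    rw [(h1 0 (mem_closedBall_self hs.le)).deriv] at h2
    simp only [sub_zero] at h2
    rw [zero_smul, add_zero] at h2
    rw [← h2, circleIntegral]
    simp only [smul_smul]
  refine DifferentiableAt.congr_of_eventuallyEq ?_ key
  refine DifferentiableAt.const_smul (differentiableAt_integral_translates hU hf ?_
    (γ := fun t => circleMap 0 s t • v) (by fun_prop) ?_) _
  · simp only [deriv_circleMap]
    have : ∀ t, circleMap 0 s t ≠ 0 := fun t => circleMap_ne_center hs.ne'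
    fun_prop (disch := exact fun t => pow_ne_zero 2 (this t))
  · exact fun t => hmem z₀ (mem_ball_self (half_pos hr)) _
      (sphere_subset_closedBall (circleMap_mem_sphere 0 hs.le t))

theorem differentiableOn_fderiv [CompleteSpace F] {U : Set E} (hU : IsOpen U) {f : E → F}
    (hf : DifferentiableOn ℂ f U) : DifferentiableOn ℂ (fderiv ℂ f) U :=
  (contDiffOn_clm_apply.2 fun v =>
    contDiffOn_one_of_differentiableOn hU (differentiableOn_fderiv_apply hU hf v)).differentiableOn
    one_ne_zero

end SeveralVariables

/-! ### Radó's theorem in one variable. -/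

section Rado

variable {c w : ℂ} {R : ℝ} {f h : ℂ → ℂ}

/-- Maximum principle relative to a function `f` that is holomorphic off its zeros. -/
theorem norm_le_of_differentiableAt_off_zeros (hR : 0 < R)
    (hf : ContinuousOn f (closedBall c R))
    (hfd : ∀ z ∈ ball c R, f z ≠ 0 → DifferentiableAt ℂ f z)
    (hh : ContinuousOn h (closedBall c R))
    (hhd : ∀ z ∈ ball c R, DifferentiableAt ℂ f z → DifferentiableAt ℂ h z)
    {M : ℝ} (hM : ∀ z ∈ sphere c R, ‖h z‖ ≤ M) {z : ℂ} (hz : z ∈ ball c R) : ‖h z‖ ≤ M := by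
  have hM0 : 0 ≤ M := by
    obtain ⟨x, hx⟩ := (NormedSpace.sphere_nonempty (x := c) (r := R)).2 hR.le
    exact (norm_nonneg _).trans (hM x hx)
  obtain ⟨B, hB⟩ := (isCompact_closedBall c R).exists_bound_of_continuousOn hf
  set U : Set ℂ := ball c R ∩ f ⁻¹' {0}ᶜ with hUdef
  have hUo : IsOpen U :=
    (hf.mono ball_subset_closedBall).isOpen_inter_preimage isOpen_ball isOpen_compl_singleton
  have hUc : closure U ⊆ closedBall c R :=
    (closure_mono inter_subset_left).trans closure_ball_subset_closedBall
  have hb : Bornology.IsBounded U := isBounded_ball.subset inter_subset_left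
  have hsph : ∀ x ∈ closedBall c R, x ∉ ball c R → x ∈ sphere c R := fun x hx hx' => by
    simp only [mem_closedBall, mem_ball, mem_sphere, not_lt] at *
    exact le_antisymm hx hx'
  have step1 : ∀ x ∈ U, ‖h x‖ ≤ M := by
    intro x hx
    -- The factor f kills the part of the frontier inside the disc, so only the circle matters.
    -- Letting N tend to infinity removes f and B from the bound.
    have hN : ∀ N : ℕ, ‖h x‖ ^ N * ‖f x‖ ≤ M ^ N * B := by
      intro N
      have hd : DiffContOnCl ℂ (fun y => h y ^ N * f y) U := by
        refine ⟨fun y hy => ?_, ((hh.pow N).mul hf).mono hUc⟩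
        have h1 := hfd y hy.1 hy.2
        exact (((hhd y hy.1 h1).pow N).mul h1).differentiableWithinAt
      have := Complex.norm_le_of_forall_mem_frontier_norm_le hb hd (C := M ^ N * B) ?_
        (subset_closure hx)
      · simpa using this
      · intro y hy
        rw [hUo.frontier_eq] at hy
        have hyc := hUc hy.1
        rw [norm_mul, norm_pow]
        by_cases hyb : y ∈ ball c R
        · have : f y = 0 := by
            by_contra hne
            exact hy.2 ⟨hyb, hne⟩
          have hB0 : 0 ≤ B := (norm_nonneg _).trans (hB y hyc)
          rw [this, norm_zero, mul_zero]
          positivity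
        · have := hM y (hsph y hyc hyb)
          gcongr
          exact hB y hyc
    by_contra! hlt
    have hq : 0 < ‖h x‖ := hM0.trans_lt hlt
    have hlim : Tendsto (fun N : ℕ => (M / ‖h x‖) ^ N * B) atTop (𝓝 (0 * B)) :=
      (tendsto_pow_atTop_nhds_zero_of_lt_one (by positivity)
        ((div_lt_one hq).2 hlt)).mul_const B
    have : ‖f x‖ ≤ 0 * B := ge_of_tendsto' hlim fun N => by
      rw [div_pow, div_mul_eq_mul_div, le_div_iff₀ (by positivity), mul_comm]
      exact hN N
    rw [zero_mul] at this
    exact hx.2 (norm_le_zero_iff.1 this)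
  have step2 : ∀ x ∈ closure U, ‖h x‖ ≤ M := by
    intro x hx
    have h1 : ContinuousWithinAt (fun y => ‖h y‖) U x :=
      ((hh x (hUc hx)).mono (subset_closure.trans hUc)).norm
    have : (𝓝[U] x).NeBot := mem_closure_iff_nhdsWithin_neBot.1 hx
    exact le_of_tendsto h1 (eventually_mem_nhdsWithin.mono step1)
  by_cases hzU : z ∈ closure U
  · exact step2 z hzU
  -- Off the closure of {f ≠ 0} the function f is locally zero, so h is holomorphic there; the
  -- frontier of Z lies in that closure or on the circle.
  set Z : Set ℂ := ball c R ∩ (closure U)ᶜ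
  have hZo : IsOpen Z := isOpen_ball.inter isClosed_closure.isOpen_compl
  have hZc : closure Z ⊆ closedBall c R :=
    (closure_mono inter_subset_left).trans closure_ball_subset_closedBall
  have hf0 : ∀ x ∈ Z, f x = 0 := fun x hx => by
    by_contra hne
    exact hx.2 (subset_closure ⟨hx.1, hne⟩)
  have hd : DiffContOnCl ℂ h Z := by
    refine ⟨fun x hx => (hhd x hx.1 ?_).differentiableWithinAt, hh.mono hZc⟩
    have : f =ᶠ[𝓝 x] fun _ => 0 := Filter.eventually_of_mem (hZo.mem_nhds hx) hf0
    exact (differentiableAt_const 0).congr_of_eventuallyEq this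
  refine Complex.norm_le_of_forall_mem_frontier_norm_le (isBounded_ball.subset inter_subset_left)
    hd (fun x hx => ?_) (subset_closure ⟨hz, hzU⟩)
  rw [hZo.frontier_eq] at hx
  by_cases hxb : x ∈ ball c R
  · refine step2 x ?_
    by_contra hne
    exact hx.2 ⟨hxb, hne⟩
  · exact hM x (hsph x (hZc hx.1) hxb)

/-- Real parts of entire functions are uniformly dense in the continuous real functions on a
circle. -/
theorem exists_entire_re_approx (hR : 0 < R) {u : ℂ → ℝ} (hu : ContinuousOn u (sphere c R))
    {ε : ℝ} (hε : 0 < ε) :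
    ∃ p : ℂ → ℂ, Differentiable ℂ p ∧ ∀ z ∈ sphere c R, |u z + (p z).re| ≤ ε := by
  set e : UnitAddCircle → ℂ := fun x => c + R * (AddCircle.toCircle x : ℂ)
  have hes : ∀ x, e x ∈ sphere c R := fun x => by
    simp [e, abs_of_pos hR, Circle.norm_coe]
  have hec : Continuous e := by fun_prop
  have hsurj : ∀ z ∈ sphere c R, ∃ x, e x = z := fun z hz => by
    have h1 : ‖(z - c) / R‖ = 1 := by
      rw [mem_sphere, dist_eq_norm] at hz
      simp [hz, abs_of_pos hR, hR.ne']
    obtain ⟨x, hx⟩ := (AddCircle.homeomorphCircle (T := 1) one_ne_zero).surjective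
      ⟨(z - c) / R, by simpa [Submonoid.unitSphere] using h1⟩
    refine ⟨x, ?_⟩
    have hx' : (AddCircle.toCircle x : ℂ) = (z - c) / R := by
      rw [← AddCircle.homeomorphCircle_apply one_ne_zero x, hx]
    have : (R : ℂ) ≠ 0 := by exact_mod_cast hR.ne'
    simp only [e, hx']
    field_simp
    ring
  set v : C(UnitAddCircle, ℂ) :=
    ⟨fun x => (u (e x) : ℂ), Complex.continuous_ofReal.comp (hu.comp_continuous hec hes)⟩
  have hv : v ∈ (Submodule.span ℂ (range (fourier (T := 1)))).topologicalClosure := by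
    rw [span_fourier_closure_eq_top]; trivial
  obtain ⟨q, hq, hqv⟩ := Metric.mem_closure_iff.1 hv ε hε
  -- Negative frequencies become positive under conjugation, which does not change the real part.
  -- The free scalar a lets the induction pass through complex multiples.
  have key : ∀ q ∈ Submodule.span ℂ (range (fourier (T := 1))), ∀ a : ℂ,
      ∃ p : ℂ → ℂ, Differentiable ℂ p ∧ ∀ x, (p (e x)).re = (a * q x).re := by
    intro q hq
    induction hq using Submodule.span_induction with
    | mem q hq =>
      obtain ⟨n, rfl⟩ := hq
      intro a
      have he : ∀ x, (e x - c) / R = (AddCircle.toCircle x : ℂ) := fun x => by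
        have : (R : ℂ) ≠ 0 := by exact_mod_cast hR.ne'
        simp only [e]
        field_simp
        ring
      obtain ⟨m, rfl | rfl⟩ := n.eq_nat_or_neg
      · refine ⟨fun z => a * ((z - c) / R) ^ m, by fun_prop, fun x => ?_⟩
        simp only [he]
        congr 2
        simp [fourier_apply, AddCircle.toCircle_nsmul]
      · refine ⟨fun z => (starRingEnd ℂ) a * ((z - c) / R) ^ m, by fun_prop, fun x => ?_⟩
        simp only [he]
        rw [fourier_neg, ← Complex.conj_re]
        simp [fourier_apply, AddCircle.toCircle_nsmul]
    | zero => exact fun a => ⟨0, by fun_prop, fun x => by simp⟩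
    | add q₁ q₂ _ _ h₁ h₂ =>
      intro a
      obtain ⟨p₁, hp₁, hp₁'⟩ := h₁ a
      obtain ⟨p₂, hp₂, hp₂'⟩ := h₂ a
      exact ⟨p₁ + p₂, hp₁.add hp₂, fun x => by
        rw [Pi.add_apply, Complex.add_re, hp₁', hp₂', ContinuousMap.add_apply, mul_add,
          Complex.add_re]⟩
    | smul b q _ h =>
      intro a
      obtain ⟨p, hp, hp'⟩ := h (a * b)
      exact ⟨p, hp, fun x => by rw [hp', ContinuousMap.smul_apply, smul_eq_mul, mul_assoc]⟩
  obtain ⟨p, hp, hpq⟩ := key q hq (-1)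
  refine ⟨p, hp, fun z hz => ?_⟩
  obtain ⟨x, rfl⟩ := hsurj z hz
  have h1 : ‖v x - q x‖ ≤ ε := by
    rw [dist_eq_norm] at hqv
    exact ((v - q).norm_coe_le_norm x).trans hqv.le
  rw [hpq]
  have h2 := (Complex.abs_re_le_norm (v x - q x)).trans h1
  simpa [v, sub_eq_add_neg] using h2

theorem continuousOn_poissonKernel_sphere (hw : w ∈ ball c R) :
    ContinuousOn (poissonKernel c w) (sphere c R) := by
  have : ∀ z ∈ sphere c R, ‖z - c - (w - c)‖ ^ 2 ≠ 0 := fun z hz => by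
    have : z ≠ w := sphere_disjoint_ball.ne_of_mem hz hw
    simpa [sub_eq_zero] using this
  simp only [funext (poissonKernel_def c w)]
  fun_prop (disch := assumption)

/-- Re(k f) is nearly -Re p on the circle for some entire p. The relative maximum principle carries
this to the point w, where k = 1, while the Poisson formula holds for p. The factor k is what later
turns the Poisson kernel into the Cauchy kernel. -/
theorem re_eq_circleAverage_of_differentiableAt_off_zeros (hR : 0 < R)
    (hf : ContinuousOn f (closedBall c R))
    (hfd : ∀ z ∈ ball c R, f z ≠ 0 → DifferentiableAt ℂ f z) (hw : w ∈ ball c R)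
    {k : ℂ → ℂ} (hk : Differentiable ℂ k) (hkw : k w = 1) :
    Real.circleAverage (fun z => poissonKernel c w z * (k z * f z).re) c R = (f w).re := by
  have hP := continuousOn_poissonKernel_sphere hw
  have hP0 : ∀ z ∈ sphere c R, 0 ≤ poissonKernel c w z := fun z hz => by
    rw [poissonKernel_def]
    rw [mem_sphere, dist_eq_norm] at hz
    rw [mem_ball, dist_eq_norm] at hw
    rw [hz]
    refine div_nonneg ?_ (by positivity)
    nlinarith [norm_nonneg (w - c)]
  have hu : ContinuousOn (fun z => (k z * f z).re) (sphere c R) :=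
    Complex.continuous_re.comp_continuousOn
      (hk.continuous.continuousOn.mul (hf.mono sphere_subset_closedBall))
  have hpois : ∀ p : ℂ → ℂ, Differentiable ℂ p →
      Real.circleAverage (fun z => poissonKernel c w z * (p z).re) c R = (p w).re := fun p hp => by
    rw [← DiffContOnCl.circleAverage_poissonKernel_smul (f := p) hp.diffContOnCl hw,
      ← Complex.reCLM_apply, ← ContinuousLinearMap.circleAverage_comp_comm]
    · congr 1
      ext z
      simp
    · exact (hP.smul hp.continuous.continuousOn).circleIntegrable hR.le
  have hmean : ∀ p : ℂ → ℂ, Differentiable ℂ p → ∀ δ : ℝ, 0 < δ →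
      (∀ z ∈ sphere c R, |(k z * f z).re + (p z).re| ≤ δ) → |(f w).re + (p w).re| ≤ δ := by
    intro p hp δ hδ hpδ
    -- The exponential turns a bound on s times the real part into a bound on a modulus; s = 1 and s
    -- = -1 are used.
    have hsign : ∀ s : ℝ, (∀ x : ℝ, s * x ≤ |x|) → s * ((f w).re + (p w).re) ≤ δ := by
      intro s hs
      have := norm_le_of_differentiableAt_off_zeros hR hf hfd
        (h := fun z => Complex.exp (s * (k z * f z + p z)))
        (M := Real.exp δ) ?_ ?_ ?_ hw
      · rw [Complex.norm_exp, Real.exp_le_exp, Complex.re_ofReal_mul, Complex.add_re, hkw,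
          one_mul] at this
        exact this
      · have := hk.continuous
        have := hp.continuous
        fun_prop
      · intro z _ hz
        have := hk z
        have := hp z
        fun_prop
      · intro z hz
        rw [Complex.norm_exp, Real.exp_le_exp, Complex.re_ofReal_mul, Complex.add_re]
        exact (hs _).trans (hpδ z hz)
    rw [abs_le]
    have h1 := hsign 1 fun x => by simpa using le_abs_self x
    have h2 := hsign (-1) fun x => by simpa using neg_le_abs x
    constructor <;> linarith
  refine eq_of_abs_sub_le_all fun ε hε => ?_
  obtain ⟨p, hp, hpε⟩ := exists_entire_re_approx hR hu (half_pos hε)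
  have h1 := hmean p hp _ (half_pos hε) hpε
  have hPu : CircleIntegrable (fun z => poissonKernel c w z * (k z * f z).re) c R :=
    (hP.mul hu).circleIntegrable hR.le
  have hPp : CircleIntegrable (fun z => poissonKernel c w z * (p z).re) c R :=
    (hP.mul (Complex.continuous_re.comp hp.continuous).continuousOn).circleIntegrable hR.le
  have hPe : CircleIntegrable (fun z => poissonKernel c w z * ((ε / 2 : ℝ) : ℂ).re) c R :=
    (hP.mul continuousOn_const).circleIntegrable hR.le
  have h2 : |Real.circleAverage (fun z => poissonKernel c w z * (k z * f z).re) c R + (p w).re| ≤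
      ε / 2 := by
    rw [← hpois p hp, ← Real.circleAverage_fun_add hPu hPp]
    refine (Real.abs_circleAverage_le_circleAverage_abs).trans ?_
    have h3 := hpois (fun _ => ((ε / 2 : ℝ) : ℂ)) (differentiable_const _)
    rw [Complex.ofReal_re] at h3
    rw [← h3]
    refine Real.circleAverage_mono (hPu.add hPp).abs ?_ ?_
    · simpa using hPe
    · intro z hz
      rw [abs_of_pos hR] at hz
      simp only [Pi.abs_apply]
      rw [← mul_add, abs_mul, abs_of_nonneg (hP0 z hz)]
      exact mul_le_mul_of_nonneg_left (hpε z hz) (hP0 z hz)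
  rw [abs_le] at *
  constructor <;> linarith

/-- On the circle R² = |z - c|², so the numerator of k is (z - c) times the conjugate of z - w, and
the Poisson kernel times k equals (z - c)/(z - w). Imaginary parts follow by using -i f. -/
theorem circleAverage_of_differentiableAt_off_zeros (hR : 0 < R)
    (hf : ContinuousOn f (closedBall c R))
    (hfd : ∀ z ∈ ball c R, f z ≠ 0 → DifferentiableAt ℂ f z) (hw : w ∈ ball c R) :
    Real.circleAverage (fun z => ((z - c) / (z - w)) • f z) c R = f w := by
  have hwR : ‖w - c‖ < R := by simpa [dist_eq_norm] using hw
  have hpos : (0 : ℝ) < R ^ 2 - ‖w - c‖ ^ 2 := by nlinarith [norm_nonneg (w - c)]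
  have hne : (R : ℂ) ^ 2 - (‖w - c‖ : ℂ) ^ 2 ≠ 0 := by exact_mod_cast hpos.ne'
  set k : ℂ → ℂ := fun z =>
    ((R : ℂ) ^ 2 - (starRingEnd ℂ) (w - c) * (z - c)) / ((R : ℂ) ^ 2 - (‖w - c‖ : ℂ) ^ 2) with hkdef
  have hk : Differentiable ℂ k := by fun_prop
  have hkw : k w = 1 := by
    simp only [hkdef, Complex.conj_mul']
    exact div_self hne
  have hP := continuousOn_poissonKernel_sphere hw
  have hfs := hf.mono (sphere_subset_closedBall)
  have hint : CircleIntegrable (fun z => (poissonKernel c w z : ℂ) * (k z * f z)) c R :=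
    ((Complex.continuous_ofReal.comp_continuousOn hP).mul
      (hk.continuous.continuousOn.mul hfs)).circleIntegrable hR.le
  have hcongr : Real.circleAverage (fun z => ((z - c) / (z - w)) • f z) c R =
      Real.circleAverage (fun z => (poissonKernel c w z : ℂ) * (k z * f z)) c R := by
    refine Real.circleAverage_congr_sphere fun z hz => ?_
    rw [abs_of_pos hR] at hz
    have hzw : z - w ≠ 0 := sub_ne_zero.2 (sphere_disjoint_ball.ne_of_mem hz hw)
    rw [mem_sphere, dist_eq_norm] at hz
    have h1 : (R : ℂ) ^ 2 = (starRingEnd ℂ) (z - c) * (z - c) := by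
      rw [Complex.conj_mul', hz]
    have h2 : ((‖z - w‖ : ℝ) : ℂ) ^ 2 = (starRingEnd ℂ) (z - w) * (z - w) :=
      (Complex.conj_mul' _).symm
    have h3 : (starRingEnd ℂ) (z - w) ≠ 0 :=
      (map_ne_zero _).2 hzw
    simp only [smul_eq_mul, poissonKernel_def, hkdef, hz, sub_sub_sub_cancel_right]
    push_cast
    rw [h2]
    have h4 : (starRingEnd ℂ) (z - w) = (starRingEnd ℂ) (z - c) - (starRingEnd ℂ) (w - c) := by
      rw [← map_sub]; congr 1; ring
    field_simp
    rw [h4, h1]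
    ring
  rw [hcongr]
  apply Complex.ext
  · rw [← re_eq_circleAverage_of_differentiableAt_off_zeros hR hf hfd hw hk hkw,
      ← Complex.reCLM_apply, ← ContinuousLinearMap.circleAverage_comp_comm _ hint]
    congr 1
    ext z
    simp
  · have := re_eq_circleAverage_of_differentiableAt_off_zeros hR (f := fun z => -Complex.I * f z)
      (continuousOn_const.mul hf) (fun z hz hz' => (hfd z hz (by
        intro h0; exact hz' (by simp [h0]))).const_mul _) hw hk hkw
    have h5 : ∀ x : ℂ, (-Complex.I * x).re = x.im := fun x => by simp
    rw [h5] at this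
    rw [← this, ← Complex.imCLM_apply, ← ContinuousLinearMap.circleAverage_comp_comm _ hint]
    congr 1
    ext z
    have : k z * (-Complex.I * f z) = -Complex.I * (k z * f z) := by ring
    rw [this, h5]
    simp

/-- **Radó's theorem**: a continuous function that is holomorphic off its zeros is holomorphic. -/
theorem differentiableOn_of_differentiableAt_off_zeros
    (hf : ContinuousOn f (closedBall c R))
    (hfd : ∀ z ∈ ball c R, f z ≠ 0 → DifferentiableAt ℂ f z) : DifferentiableOn ℂ f (ball c R) := by
  rcases le_or_gt R 0 with hR | hR
  · rw [ball_eq_empty.2 hR]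
    exact differentiableOn_empty
  lift R to NNReal using hR.le
  have hint : CircleIntegrable f c R :=
    (hf.mono sphere_subset_closedBall).circleIntegrable hR.le
  -- The Cauchy integral is holomorphic for any integrable boundary values; it remains to identify
  -- it with f.
  have h := (hasFPowerSeriesOn_cauchy_integral hint (by exact_mod_cast hR)).differentiableOn
  rw [eball_coe] at h
  refine h.congr fun w hw => ?_
  rw [← circleAverage_of_differentiableAt_off_zeros hR hf hfd hw,
    Real.circleAverage_eq_circleIntegral hR.ne']
  congr 1
  refine circleIntegral.integral_congr hR.le fun z hz => ?_
  have hzc : z - c ≠ 0 := sub_ne_zero.2 (ne_of_mem_sphere hz hR.ne')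
  simp only [smul_eq_mul]
  field_simp

end Rado

/-! ### Riemann extension across the zeros of a continuous function. -/

section Removable

variable {E F : Type*} [NormedAddCommGroup E] [NormedSpace ℂ E]
  [NormedAddCommGroup F] [NormedSpace ℂ F] [CompleteSpace F]

/-- The mean value property of a bounded function that is holomorphic off the zeros of a
holomorphic function. -/
theorem circleAverage_of_bounded_off_zeros {R r : ℝ} (hr : 0 < r) (hrR : r < R) {τ : ℂ → ℂ}
    (hτ : DifferentiableOn ℂ τ (ball 0 R)) (hτ0 : τ 0 ≠ 0) (hτr : ∀ l ∈ sphere (0 : ℂ) r, τ l ≠ 0)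
    {φ : ℂ → F} (hφ : ∀ l ∈ ball (0 : ℂ) R, τ l ≠ 0 → DifferentiableAt ℂ φ l) {M : ℝ}
    (hM : ∀ l ∈ ball (0 : ℂ) R, τ l ≠ 0 → ‖φ l‖ ≤ M) : Real.circleAverage φ 0 r = φ 0 := by
  classical
  -- The zeros of τ are isolated because τ 0 ≠ 0, so filling in limits there removes the
  -- singularities of φ without changing it at 0 or on the circle.
  set ψ : ℂ → F := fun l => if τ l = 0 then limUnder (𝓝[≠] l) φ else φ l with hψ
  have hτa : AnalyticOnNhd ℂ τ (ball 0 R) := hτ.analyticOnNhd isOpen_ball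
  have hd : ∀ l ∈ ball (0 : ℂ) R, DifferentiableAt ℂ ψ l := by
    intro l hl
    have hne : ∀ᶠ x in 𝓝[≠] l, τ x ≠ 0 := by
      refine (hτa l hl).eventually_eq_zero_or_eventually_ne_zero.resolve_left fun h => hτ0 ?_
      exact hτa.eqOn_zero_of_preconnected_of_eventuallyEq_zero (convex_ball _ _).isPreconnected hl h
        (mem_ball_self (hr.trans hrR))
    obtain ⟨s, hs, hsτ⟩ := mem_nhdsWithin_iff_exists_mem_nhds_inter.1 hne
    have hsR : s ∩ ball 0 R ∈ 𝓝 l := inter_mem hs (isOpen_ball.mem_nhds hl)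
    by_cases h0 : τ l = 0
    · have h1 := Complex.differentiableOn_update_limUnder_of_bddAbove (f := φ) hsR
        (fun x hx => (hφ x hx.1.2 (hsτ ⟨hx.1.1, hx.2⟩)).differentiableWithinAt)
        ⟨M, by rintro _ ⟨x, hx, rfl⟩; exact hM x hx.1.2 (hsτ ⟨hx.1.1, hx.2⟩)⟩
      refine (h1.differentiableAt hsR).congr_of_eventuallyEq ?_
      filter_upwards [hs] with x hx
      by_cases hxl : x = l
      · subst hxl
        simp [hψ, h0]
      · have : τ x ≠ 0 := hsτ ⟨hx, hxl⟩
        simp [hψ, this, hxl]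
    · refine (hφ l hl h0).congr_of_eventuallyEq ?_
      filter_upwards [(hτa l hl).continuousAt.eventually_ne h0] with x hx
      simp [hψ, hx]
  have h1 := DiffContOnCl.circleAverage (f := ψ) (c := 0) (R := r) (by
    rw [abs_of_pos hr]
    exact DifferentiableOn.diffContOnCl_ball (fun l hl =>
      (hd l (closedBall_subset_ball hrR hl)).differentiableWithinAt) subset_rfl)
  have h2 : ψ 0 = φ 0 := by simp [hψ, hτ0]
  rw [← h2, ← h1]
  refine Real.circleAverage_congr_sphere fun l hl => ?_
  rw [abs_of_pos hr] at hl
  simp [hψ, hτr l hl]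

variable [FiniteDimensional ℂ E]

/-- Choose v with δ(w₀ + v) ≠ 0. By Radó, δ is holomorphic on the discs w + l v, so some circle
about w₀ avoids its zeros, and so do its translates for w near w₀. The average of f over the
translated circle is holomorphic in w, and the mean value property identifies it with f. -/
theorem exists_local_extension_of_bounded_off_zeros {G : Set E} (hG : IsOpen G) {δ : E → ℂ}
    (hδ : ContinuousOn δ G) (hδd : ∀ w ∈ G, δ w ≠ 0 → DifferentiableAt ℂ δ w)
    (hdense : G ⊆ closure {w | δ w ≠ 0}) {f : E → F}
    (hf : ∀ w ∈ G, δ w ≠ 0 → DifferentiableAt ℂ f w) {w₀ : E} (hw₀ : w₀ ∈ G)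
    (hb : ∃ M : ℝ, ∀ᶠ w in 𝓝 w₀, δ w ≠ 0 → ‖f w‖ ≤ M) :
    ∃ F₀ : E → F, ∃ V : Set E, IsOpen V ∧ w₀ ∈ V ∧ V ⊆ G ∧ DifferentiableOn ℂ F₀ V ∧
      ∀ w ∈ V, δ w ≠ 0 → F₀ w = f w := by
  have : ProperSpace E := FiniteDimensional.proper ℂ E
  obtain ⟨M, hM⟩ := hb
  obtain ⟨ε, hε, hεG⟩ := Metric.mem_nhds_iff.1 (hM.and (hG.mem_nhds hw₀))
  -- With ‖v‖ < ε/4, discs of parameter radius 2 centred in the ball of radius ε/4 stay in the ball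
  -- of radius ε; radius 2 keeps l = 1 in the interior.
  obtain ⟨w₁, hw₁, hδ₁⟩ := mem_closure_iff.1 (hdense hw₀) (ball w₀ (ε / 4)) isOpen_ball
    (mem_ball_self (by positivity))
  obtain ⟨v, rfl⟩ : ∃ v, w₁ = w₀ + v := ⟨w₁ - w₀, by abel⟩
  have hv : ‖v‖ < ε / 4 := by simpa using hw₁
  have hmem : ∀ w ∈ ball w₀ (ε / 4), ∀ l ∈ closedBall (0 : ℂ) 2, w + l • v ∈ ball w₀ ε := by
    intro w hw l hl
    rw [mem_ball, dist_eq_norm] at *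
    have hl' : ‖l‖ ≤ 2 := by simpa using hl
    calc ‖w + l • v - w₀‖ = ‖(w - w₀) + l • v‖ := by congr 1; abel
      _ ≤ ‖w - w₀‖ + ‖l • v‖ := norm_add_le _ _
      _ ≤ ‖w - w₀‖ + 2 * ‖v‖ := by rw [norm_smul]; gcongr
      _ < ε := by linarith
  have hτ : ∀ w ∈ ball w₀ (ε / 4), DifferentiableOn ℂ (fun l : ℂ => δ (w + l • v)) (ball 0 2) := by
    intro w hw
    refine differentiableOn_of_differentiableAt_off_zeros ?_ ?_
    · exact hδ.comp (by fun_prop) fun l hl => (hεG (hmem w hw l hl)).2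
    · intro l hl hne
      exact (hδd _ (hεG (hmem w hw l (ball_subset_closedBall hl))).2 hne).comp l (by fun_prop)
  have hw₀b : w₀ ∈ ball w₀ (ε / 4) := mem_ball_self (by positivity)
  obtain ⟨r, hr, hr2, hrτ⟩ : ∃ r : ℝ, 0 < r ∧ r < 2 ∧
      ∀ l ∈ sphere (0 : ℂ) r, δ (w₀ + l • v) ≠ 0 := by
    have ha : AnalyticOnNhd ℂ (fun l : ℂ => δ (w₀ + l • v)) (ball 0 2) :=
      (hτ w₀ hw₀b).analyticOnNhd isOpen_ball
    have h02 : (0 : ℂ) ∈ ball (0 : ℂ) 2 := mem_ball_self two_pos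
    have hne := (ha 0 h02).eventually_eq_zero_or_eventually_ne_zero.resolve_left fun h => hδ₁ <| by
      simpa using ha.eqOn_zero_of_preconnected_of_eventuallyEq_zero
        (convex_ball _ _).isPreconnected h02 h (show (1 : ℂ) ∈ ball (0 : ℂ) 2 by simp)
    obtain ⟨s, hs, hsub⟩ := Metric.mem_nhdsWithin_iff.1 hne
    refine ⟨min (s / 2) 1, by positivity, (min_le_right _ _).trans_lt (by norm_num), fun l hl => ?_⟩
    have hl' : ‖l‖ = min (s / 2) 1 := by simpa using hl
    refine hsub ⟨?_, ?_⟩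
    · rw [mem_ball_zero_iff, hl']
      exact (min_le_left _ _).trans_lt (by linarith)
    · rw [mem_compl_iff, mem_singleton_iff, ← norm_eq_zero, hl']
      positivity
  set G' : Set E := G ∩ δ ⁻¹' {0}ᶜ
  have hG' : IsOpen G' := hδ.isOpen_inter_preimage hG isOpen_compl_singleton
  have hfG' : DifferentiableOn ℂ f G' := fun w hw => (hf w hw.1 hw.2).differentiableWithinAt
  have hsph : ∀ l ∈ sphere (0 : ℂ) r, l ∈ closedBall (0 : ℂ) 2 := fun l hl =>
    closedBall_subset_closedBall hr2.le (sphere_subset_closedBall hl)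
  have hK : IsCompact ((fun l : ℂ => w₀ + l • v) '' sphere 0 r) :=
    (isCompact_sphere _ _).image (by fun_prop)
  obtain ⟨η, hη, hηG⟩ := hK.exists_cthickening_subset_open hG' (by
    rintro _ ⟨l, hl, rfl⟩
    exact ⟨(hεG (hmem w₀ hw₀b l (hsph l hl))).2, hrτ l hl⟩)
  have hVG' : ∀ w ∈ ball w₀ η, ∀ l ∈ sphere (0 : ℂ) r, w + l • v ∈ G' := fun w hw l hl => by
    refine hηG (mem_cthickening_of_dist_le _ _ _ _ (mem_image_of_mem _ hl) ?_)
    simpa using (mem_ball.1 hw).le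
  refine ⟨fun w => Real.circleAverage (fun l => f (w + l • v)) 0 r, ball w₀ η ∩ ball w₀ (ε / 4),
    isOpen_ball.inter isOpen_ball, ⟨mem_ball_self hη, hw₀b⟩, fun w hw => ?_, fun w hw => ?_,
    fun w hw hne => ?_⟩
  · have := (hεG (hmem w hw.2 0 (by simp))).2
    rwa [zero_smul, add_zero] at this
  · apply DifferentiableAt.differentiableWithinAt
    have := differentiableAt_integral_translates hG' hfG' (φ := fun _ => ((2 * Real.pi)⁻¹ : ℂ))
      continuous_const (γ := fun t => circleMap 0 r t • v) (by fun_prop) (a := 0) (b := 2 * Real.pi)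
      (w₀ := w) (fun t => hVG' w hw.1 _ (circleMap_mem_sphere 0 hr.le t))
    refine this.congr_of_eventuallyEq (Eventually.of_forall fun w => ?_)
    simp only [Real.circleAverage_def, intervalIntegral.integral_smul]
    rw [← Complex.coe_smul]
    push_cast
    rfl
  · have := circleAverage_of_bounded_off_zeros hr hr2 (hτ w hw.2) (by simpa using hne)
      (fun l hl => (hVG' w hw.1 l hl).2) (φ := fun l => f (w + l • v)) (M := M) ?_ ?_
    · simpa using this
    · intro l hl hne
      exact (hf _ (hεG (hmem w hw.2 l (ball_subset_closedBall hl))).2 hne).comp l (by fun_prop)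
    · intro l hl hne
      exact (hεG (hmem w hw.2 l (ball_subset_closedBall hl))).1 hne

/-- **Riemann extension theorem** across the zeros of a continuous function that is holomorphic
off its zeros. -/
theorem exists_extension_of_bounded_off_zeros {G : Set E} (hG : IsOpen G) {δ : E → ℂ}
    (hδ : ContinuousOn δ G) (hδd : ∀ w ∈ G, δ w ≠ 0 → DifferentiableAt ℂ δ w)
    (hdense : G ⊆ closure {w | δ w ≠ 0}) {f : E → F}
    (hf : ∀ w ∈ G, δ w ≠ 0 → DifferentiableAt ℂ f w)
    (hb : ∀ w ∈ G, ∃ M : ℝ, ∀ᶠ w' in 𝓝 w, δ w' ≠ 0 → ‖f w'‖ ≤ M) :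
    ∃ F₀ : E → F, DifferentiableOn ℂ F₀ G ∧ ∀ w ∈ G, δ w ≠ 0 → F₀ w = f w := by
  -- Defining the extension as the limit of f along {δ ≠ 0} makes the local extensions agree
  -- automatically.
  have key : ∀ w₀ ∈ G, DifferentiableAt ℂ (fun w => limUnder (𝓝[{w | δ w ≠ 0}] w) f) w₀ ∧
      (δ w₀ ≠ 0 → limUnder (𝓝[{w | δ w ≠ 0}] w₀) f = f w₀) := by
    intro w₀ hw₀
    obtain ⟨F₀, V, hV, hwV, hVG, hd, hF⟩ :=
      exists_local_extension_of_bounded_off_zeros hG hδ hδd hdense hf hw₀ (hb w₀ hw₀)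
    have heq : ∀ w ∈ V, limUnder (𝓝[{w | δ w ≠ 0}] w) f = F₀ w := by
      intro w hw
      have : (𝓝[{w | δ w ≠ 0}] w).NeBot := mem_closure_iff_nhdsWithin_neBot.1 (hdense (hVG hw))
      refine Tendsto.limUnder_eq ?_
      have h1 : Tendsto F₀ (𝓝[{w | δ w ≠ 0}] w) (𝓝 (F₀ w)) :=
        (hd.continuousOn.continuousAt (hV.mem_nhds hw)).mono_left nhdsWithin_le_nhds
      refine h1.congr' ?_
      filter_upwards [nhdsWithin_le_nhds (hV.mem_nhds hw), self_mem_nhdsWithin] with x hx hx'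
        using hF x hx hx'
    refine ⟨(hd.differentiableAt (hV.mem_nhds hwV)).congr_of_eventuallyEq ?_, fun h => ?_⟩
    · exact Filter.eventually_of_mem (hV.mem_nhds hwV) heq
    · rw [heq w₀ hwV, hF w₀ hwV h]
  exact ⟨_, fun w hw => (key w hw).1.differentiableWithinAt, fun w hw => (key w hw).2⟩

end Removable

/-! ### Proper maps, critical values and density of regular points. -/

variable {n : ℕ} {D G : Set (Cn n)} {π : Cn n → Cn n}

theorem eventually_ne_of_tendsto {α X : Type*} [TopologicalSpace X] [T2Space X] {l : Filter α}
    {f g : α → X} {x y : X} (hf : Tendsto f l (𝓝 x)) (hg : Tendsto g l (𝓝 y)) (hxy : x ≠ y) :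
    ∀ᶠ t in l, f t ≠ g t :=
  (hf.prodMk_nhds hg).eventually (isClosed_diagonal.isOpen_compl.mem_nhds hxy)

/-- The part outside N of the preimage of a small closed ball is compact, so its image is closed,
and it misses w. -/
theorem IsProperHolomorphic.eventually_fibre_subset (hπ : IsProperHolomorphic D G π)
    (hG : IsOpen G) {w : Cn n} (hw : w ∈ G) {N : Set (Cn n)} (hN : IsOpen N)
    (h : ∀ z ∈ D, π z = w → z ∈ N) : ∀ᶠ w' in 𝓝 w, ∀ z ∈ D, π z = w' → z ∈ N := by
  obtain ⟨r, hr, hrG⟩ := Metric.nhds_basis_closedBall.mem_iff.1 (hG.mem_nhds hw)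
  have hK := hπ.isCompact_preimage _ hrG (isCompact_closedBall w r)
  have hC : IsCompact (π '' ((D ∩ π ⁻¹' closedBall w r) \ N)) :=
    (hK.diff hN).image_of_continuousOn (hπ.holomorphic.continuousOn.mono fun z hz => hz.1.1)
  have hwC : w ∉ π '' ((D ∩ π ⁻¹' closedBall w r) \ N) := by
    rintro ⟨z, hz, hzw⟩
    exact hz.2 (h z hz.1.1 hzw)
  filter_upwards [hC.isClosed.isOpen_compl.mem_nhds hwC, closedBall_mem_nhds w hr]
    with w' hw' hb z hz hzw
  by_contra hne
  exact hw' ⟨z, ⟨⟨hz, by rwa [mem_preimage, hzw]⟩, hne⟩, hzw⟩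

theorem IsProperHolomorphic.exists_compact_fibre_subset (hπ : IsProperHolomorphic D G π)
    (hG : IsOpen G) {w : Cn n} (hw : w ∈ G) :
    ∃ K ⊆ D, IsCompact K ∧ ∀ᶠ w' in 𝓝 w, ∀ z ∈ D, π z = w' → z ∈ K := by
  obtain ⟨r, hr, hrG⟩ := Metric.nhds_basis_closedBall.mem_iff.1 (hG.mem_nhds hw)
  refine ⟨_, inter_subset_left, hπ.isCompact_preimage _ hrG (isCompact_closedBall w r), ?_⟩
  filter_upwards [closedBall_mem_nhds w hr] with w' hw' z hz hzw
  exact ⟨hz, by rwa [mem_preimage, hzw]⟩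

theorem differentiableOn_det_fderiv (hD : IsOpen D) (hπ : DifferentiableOn ℂ π D) :
    DifferentiableOn ℂ (fun z => (fderiv ℂ π z).det) D := by
  have h := differentiableOn_fderiv hD hπ
  set b := (EuclideanSpace.basisFun (Fin n) ℂ).toBasis
  have h1 : ∀ z, (fderiv ℂ π z).det =
      ∑ σ : Equiv.Perm (Fin n), Equiv.Perm.sign σ •
        ∏ i, (fderiv ℂ π z (b i)) (σ i) := fun z => by
    rw [ContinuousLinearMap.det, ← LinearMap.det_toMatrix b, Matrix.det_apply]
    simp [LinearMap.toMatrix_apply, b]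
  simp only [h1]
  have h2 : ∀ i j, DifferentiableOn ℂ (fun z => (fderiv ℂ π z (b i)) j) D := fun i j => by
    have h3 : DifferentiableOn ℂ (fun z => fderiv ℂ π z (b i)) D :=
      h.clm_apply (differentiableOn_const _)
    exact (EuclideanSpace.proj (𝕜 := ℂ) j).differentiable.comp_differentiableOn h3
  simp only [Units.smul_def, zsmul_eq_mul]
  refine DifferentiableOn.fun_sum fun σ _ => DifferentiableOn.const_mul ?_ _
  exact fun z hz => (HasFDerivWithinAt.finsetProd fun i _ =>
    (h2 i (σ i) z hz).hasFDerivWithinAt).differentiableWithinAt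

/-- The real Jacobian is the norm from ℂ to ℝ of the complex one, so it vanishes on the locus and
the equidimensional Sard theorem applies. -/
theorem addHaar_image_locus (hD : IsOpen D) (hπ : DifferentiableOn ℂ π D) :
    (Measure.addHaar : Measure (Cn n)) (π '' locus D π) = 0 := by
  refine addHaar_image_eq_zero_of_det_fderivWithin_eq_zero _
    (f' := fun z => (fderiv ℂ π z).restrictScalars ℝ) (fun z hz => ?_) fun z hz => ?_
  · exact ((hπ.differentiableAt (hD.mem_nhds hz.1)).hasFDerivAt.restrictScalars
      ℝ).hasFDerivWithinAt
  · have h := LinearMap.det_restrictScalars (R := ℝ) (f := (fderiv ℂ π z : Cn n →ₗ[ℂ] Cn n))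
    have h0 : LinearMap.det (fderiv ℂ π z : Cn n →ₗ[ℂ] Cn n) = 0 := hz.2
    rw [h0, Algebra.norm_zero] at h
    exact h

theorem isOpen_regularValues (hD : IsOpen D) (hG : IsOpen G) (hπ : IsProperHolomorphic D G π) :
    IsOpen (G \ π '' locus D π) := by
  rw [isOpen_iff_eventually]
  rintro w ⟨hw, hwE⟩
  have hN : IsOpen (D ∩ (fun z => (fderiv ℂ π z).det) ⁻¹' {0}ᶜ) :=
    (differentiableOn_det_fderiv hD hπ.holomorphic).continuousOn.isOpen_inter_preimage hD
      isOpen_compl_singleton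
  filter_upwards [hG.mem_nhds hw, hπ.eventually_fibre_subset hG hw hN
    fun z hz hzw => ⟨hz, fun h0 => hwE ⟨z, ⟨hz, h0⟩, hzw⟩⟩] with w' hw' h
  refine ⟨hw', ?_⟩
  rintro ⟨z, hz, hzw⟩
  exact (h z hz.1 hzw).2 hz.2

theorem frequently_regularValues (hD : IsOpen D) (hG : IsOpen G)
    (hπ : IsProperHolomorphic D G π) {w : Cn n} (hw : w ∈ G) :
    ∃ᶠ w' in 𝓝 w, w' ∈ G \ π '' locus D π := by
  intro h
  obtain ⟨V, hV, hVo, hwV⟩ := _root_.eventually_nhds_iff.1 (h.and (hG.mem_nhds hw))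
  have hsub : V ⊆ π '' locus D π := fun x hx => by
    by_contra hne
    exact (hV x hx).1 ⟨(hV x hx).2, hne⟩
  exact (hVo.measure_pos Measure.addHaar ⟨w, hwV⟩).ne'
    (measure_mono_null hsub (addHaar_image_locus hD hπ.holomorphic))

/-- A local section of `π` through a point at which `π'` is invertible. -/
theorem exists_local_section (hD : IsOpen D) (hπ : DifferentiableOn ℂ π D) {z : Cn n}
    (hz : z ∈ D) (hdet : (fderiv ℂ π z).det ≠ 0) :
    ∃ A : Cn n → Cn n, A (π z) = z ∧
      (∀ᶠ w in 𝓝 (π z), DifferentiableAt ℂ A w ∧ A w ∈ D ∧ π (A w) = w) ∧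
      ∀ᶠ z' in 𝓝 z, A (π z') = z' := by
  set e := (fderiv ℂ π z).toContinuousLinearEquivOfDetNeZero hdet
  have hc : ContDiffAt ℂ 1 π z := (contDiffOn_one_of_differentiableOn hD hπ).contDiffAt
    (hD.mem_nhds hz)
  have hf : HasFDerivAt π (e : Cn n →L[ℂ] Cn n) z :=
    (hπ.differentiableAt (hD.mem_nhds hz)).hasFDerivAt
  have hs := hc.hasStrictFDerivAt' hf one_ne_zero
  have hA := hc.to_localInverse hf one_ne_zero
  have hAz := hc.localInverse_apply_image hf one_ne_zero
  refine ⟨hc.localInverse hf one_ne_zero, hAz, ?_, hs.eventually_left_inverse⟩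
  have h1 : ∀ᶠ w in 𝓝 (π z), ContDiffAt ℂ 1 (hc.localInverse hf one_ne_zero) w :=
    hA.eventually (by simp)
  have h2 : ∀ᶠ w in 𝓝 (π z), hc.localInverse hf one_ne_zero w ∈ D :=
    hA.continuousAt.eventually (by rw [hAz]; exact hD.mem_nhds hz)
  filter_upwards [h1, h2, hs.eventually_right_inverse] with w hw1 hw2 hw3
  exact ⟨hw1.differentiableAt one_ne_zero, hw2, hw3⟩

namespace IsMProper

/-- An empty fibre would force empty fibres nearby, but there are regular values nearby, with two
preimages. -/
theorem exists_mem_fibre (hπ : IsMProper 2 D G π) (hD : IsOpen D) (hG : IsOpen G) {w : Cn n}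
    (hw : w ∈ G) : ∃ z ∈ D, π z = w := by
  by_contra! h
  have h1 := hπ.toIsProperHolomorphic.eventually_fibre_subset hG hw isOpen_empty
    fun z hz hzw => h z hz hzw
  obtain ⟨w', hw', h2⟩ :=
    ((frequently_regularValues hD hG hπ.toIsProperHolomorphic hw).and_eventually h1).exists
  have h3 := hπ.encard_fibre w' hw'
  have h4 : D ∩ π ⁻¹' {w'} = ∅ := eq_empty_of_forall_notMem fun z hz => h2 z hz.1 hz.2
  rw [h4] at h3
  simp at h3

/-- Otherwise det π' vanishes near z, since a local section at a point with det π' ≠ 0 would lift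
nearby regular values. By the identity theorem it vanishes on D, and surjectivity leaves no regular
value. -/
theorem frequently_regular (hπ : IsMProper 2 D G π) (hD : IsDom D) (hG : IsOpen G) {z : Cn n}
    (hz : z ∈ D) : ∃ᶠ z' in 𝓝 z, z' ∈ D ∧ π z' ∈ G \ π '' locus D π := by
  intro h
  obtain ⟨V, hV, hVo, hzV⟩ := _root_.eventually_nhds_iff.1 (h.and (hD.1.mem_nhds hz))
  have h0 : ∀ x ∈ V, (fderiv ℂ π x).det = 0 := by
    intro x hx
    by_contra hdet
    have hxD := (hV x hx).2
    obtain ⟨A, hAx, hA, -⟩ := exists_local_section hD.1 hπ.holomorphic hxD hdet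
    have hAV : ∀ᶠ w in 𝓝 (π x), A w ∈ V := by
      refine hA.self_of_nhds.1.continuousAt.eventually ?_
      rw [hAx]
      exact hVo.mem_nhds hx
    obtain ⟨w, hw, hAw, hwV⟩ := ((frequently_regularValues hD.1 hG hπ.toIsProperHolomorphic
      (hπ.mapsTo hxD)).and_eventually (hA.and hAV)).exists
    refine (hV _ hwV).1 ⟨hAw.2.1, ?_⟩
    rwa [hAw.2.2]
  have h1 := eqOn_zero_of_eventuallyEq_zero hD.1 hD.2.isPreconnected
    (differentiableOn_det_fderiv hD.1 hπ.holomorphic) hz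
    (Filter.eventually_of_mem (hVo.mem_nhds hzV) h0)
  obtain ⟨w, hw⟩ := (frequently_regularValues hD.1 hG hπ.toIsProperHolomorphic
    (hπ.mapsTo hz)).exists
  obtain ⟨x, hx, hxw⟩ := hπ.exists_mem_fibre hD.1 hG hw.1
  exact hw.2 ⟨x, ⟨hx, h1 hx⟩, hxw⟩

end IsMProper

/-! ### The two points of a regular fibre. -/

/-- The fibre of `π` over a regular value `w` is `{a w, b w}`, with `a w ≠ b w`. -/
def IsFibrePair (D G : Set (Cn n)) (π a b : Cn n → Cn n) : Prop :=
  ∀ w ∈ G \ π '' locus D π, a w ≠ b w ∧ D ∩ π ⁻¹' {w} = {a w, b w}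

theorem IsMProper.exists_isFibrePair (hπ : IsMProper 2 D G π) : ∃ a b, IsFibrePair D G π a b := by
  have : ∀ w, ∃ x y, w ∈ G \ π '' locus D π → x ≠ y ∧ D ∩ π ⁻¹' {w} = {x, y} := fun w => by
    by_cases hw : w ∈ G \ π '' locus D π
    · obtain ⟨x, y, h⟩ := Set.encard_eq_two.1 (hπ.encard_fibre w hw)
      exact ⟨x, y, fun _ => h⟩
    · exact ⟨0, 0, fun h => absurd h hw⟩
  choose a b h using this
  exact ⟨a, b, h⟩

namespace IsFibrePair

variable {a b : Cn n → Cn n} {w : Cn n}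

theorem mem_left (h : IsFibrePair D G π a b) (hw : w ∈ G \ π '' locus D π) :
    a w ∈ D ∧ π (a w) = w := by
  have : a w ∈ D ∩ π ⁻¹' {w} := by rw [(h w hw).2]; simp
  exact this

theorem mem_right (h : IsFibrePair D G π a b) (hw : w ∈ G \ π '' locus D π) :
    b w ∈ D ∧ π (b w) = w := by
  have : b w ∈ D ∩ π ⁻¹' {w} := by rw [(h w hw).2]; simp
  exact this

theorem eq_or_eq (h : IsFibrePair D G π a b) (hw : w ∈ G \ π '' locus D π) {z : Cn n}
    (hz : z ∈ D) (hzw : π z = w) : z = a w ∨ z = b w := by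
  have : z ∈ D ∩ π ⁻¹' {w} := ⟨hz, hzw⟩
  rw [(h w hw).2] at this
  exact this

theorem det_ne_zero (hw : w ∈ G \ π '' locus D π) {z : Cn n}
    (hz : z ∈ D) (hzw : π z = w) : (fderiv ℂ π z).det ≠ 0 := fun h0 =>
  hw.2 ⟨z, ⟨hz, h0⟩, hzw⟩

/-- Near a regular value the two points of the fibre are given by two holomorphic branches. -/
theorem exists_branches (h : IsFibrePair D G π a b) (hD : IsOpen D) (hG : IsOpen G)
    (hπ : IsProperHolomorphic D G π) (hw : w ∈ G \ π '' locus D π) :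
    ∃ A B : Cn n → Cn n, A w = a w ∧ B w = b w ∧ DifferentiableAt ℂ A w ∧ DifferentiableAt ℂ B w ∧
      ∀ᶠ x in 𝓝 w, (a x = A x ∧ b x = B x) ∨ (a x = B x ∧ b x = A x) := by
  obtain ⟨haD, haw⟩ := h.mem_left hw
  obtain ⟨hbD, hbw⟩ := h.mem_right hw
  obtain ⟨A, hA0, hA, -⟩ := exists_local_section hD hπ.holomorphic haD (det_ne_zero hw haD haw)
  obtain ⟨B, hB0, hB, -⟩ := exists_local_section hD hπ.holomorphic hbD (det_ne_zero hw hbD hbw)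
  rw [haw] at hA0 hA
  rw [hbw] at hB0 hB
  have hAd := hA.self_of_nhds.1
  have hBd := hB.self_of_nhds.1
  refine ⟨A, B, hA0, hB0, hAd, hBd, ?_⟩
  have hne : ∀ᶠ x in 𝓝 w, A x ≠ B x := by
    refine eventually_ne_of_tendsto hAd.continuousAt hBd.continuousAt ?_
    rw [hA0, hB0]
    exact (h w hw).1
  filter_upwards [hA, hB, hne, (isOpen_regularValues hD hG hπ).mem_nhds hw] with x hx1 hx2 hx3 hx
  have h1 := h.eq_or_eq hx hx1.2.1 hx1.2.2
  have h2 := h.eq_or_eq hx hx2.2.1 hx2.2.2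
  rcases h1 with h1 | h1 <;> rcases h2 with h2 | h2
  · exact absurd (h1.trans h2.symm) hx3
  · exact Or.inl ⟨h1.symm, h2.symm⟩
  · exact Or.inr ⟨h2.symm, h1.symm⟩
  · exact absurd (h1.trans h2.symm) hx3

/-- The choice of a and b need not be continuous: they agree with the holomorphic branches only up
to a swap, which s does not see. -/
theorem differentiableAt_symmetric {F : Type*} [NormedAddCommGroup F] [NormedSpace ℂ F]
    (h : IsFibrePair D G π a b) (hD : IsOpen D) (hG : IsOpen G)
    (hπ : IsProperHolomorphic D G π) (hw : w ∈ G \ π '' locus D π) {s : Cn n → Cn n → F}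
    (hs : ∀ x y, s x y = s y x)
    (hd : DifferentiableAt ℂ (fun p : Cn n × Cn n => s p.1 p.2) (a w, b w)) :
    DifferentiableAt ℂ (fun x => s (a x) (b x)) w := by
  obtain ⟨A, B, hA0, hB0, hA, hB, hAB⟩ := h.exists_branches hD hG hπ hw
  rw [← hA0, ← hB0] at hd
  have h1 : DifferentiableAt ℂ (fun x => s (A x) (B x)) w :=
    DifferentiableAt.comp (g := fun p : Cn n × Cn n => s p.1 p.2) w hd (hA.prodMk hB)
  refine h1.congr_of_eventuallyEq ?_
  filter_upwards [hAB] with x hx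
  rcases hx with hx | hx
  · rw [hx.1, hx.2]
  · rw [hx.1, hx.2, hs]

/-- Over a regular value close to a critical value the fibre contains a point at which `det π'`
is small. -/
theorem eventually_small_det (h : IsFibrePair D G π a b) (hD : IsDom D) (hG : IsOpen G)
    (hπ : IsMProper 2 D G π) {z : Cn n} (hz : z ∈ locus D π) {η : ℝ} (hη : 0 < η) :
    ∀ᶠ w in 𝓝 (π z), w ∈ G \ π '' locus D π →
      ‖(fderiv ℂ π (a w)).det‖ < η ∨ ‖(fderiv ℂ π (b w)).det‖ < η := by
  have hπp := hπ.toIsProperHolomorphic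
  by_contra hcon
  obtain ⟨K, hKD, hK, hKev⟩ := hπp.exists_compact_fibre_subset hG (hπ.mapsTo hz.1)
  set S : Set (Cn n) := {w | w ∈ G \ π '' locus D π ∧
    η ≤ ‖(fderiv ℂ π (a w)).det‖ ∧ η ≤ ‖(fderiv ℂ π (b w)).det‖} with hS
  have hfreq : ∃ᶠ w in 𝓝 (π z), w ∈ S := by
    rw [not_eventually] at hcon
    refine hcon.mono fun w hw => ?_
    push Not at hw
    -- Along an ultrafilter on such regular values tending to π z, properness makes a and b converge
    -- in D, to points of the fibre of π z where det π' ≠ 0.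
    exact ⟨hw.1, hw.2⟩
  have hne : (𝓝 (π z) ⊓ 𝓟 S).NeBot := frequently_mem_iff_neBot.1 hfreq
  set U := Ultrafilter.of (𝓝 (π z) ⊓ 𝓟 S)
  have hU : (U : Filter (Cn n)) ≤ 𝓝 (π z) := (Ultrafilter.of_le _).trans inf_le_left
  have hUS : ∀ᶠ w in (U : Filter (Cn n)), w ∈ S :=
    (Ultrafilter.of_le _).trans inf_le_right (mem_principal_self S)
  have hlim : ∀ f : Cn n → Cn n, (∀ w ∈ S, f w ∈ D ∧ π (f w) = w ∧
      η ≤ ‖(fderiv ℂ π (f w)).det‖) →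
      ∃ x ∈ D, π x = π z ∧ (fderiv ℂ π x).det ≠ 0 ∧ Tendsto f U (𝓝 x) := by
    intro f hf
    have hfK : ∀ᶠ w in (U : Filter (Cn n)), f w ∈ K := by
      filter_upwards [hUS, hU hKev] with w hw hw'
      exact hw' _ (hf w hw).1 (hf w hw).2.1
    obtain ⟨x, hxK, hx⟩ := hK.ultrafilter_le_nhds (U.map f) (le_principal_iff.2 hfK)
    have hx : Tendsto f U (𝓝 x) := hx
    have hxD := hKD hxK
    refine ⟨x, hxD, ?_, fun h0 => ?_, hx⟩
    · have h1 : Tendsto (fun w => π (f w)) U (𝓝 (π x)) :=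
        (hπ.holomorphic.continuousOn.continuousAt (hD.1.mem_nhds hxD)).tendsto.comp hx
      refine tendsto_nhds_unique h1 (Tendsto.congr' ?_ hU)
      filter_upwards [hUS] with w hw using (hf w hw).2.1.symm
    · have h1 : Tendsto (fun w => ‖(fderiv ℂ π (f w)).det‖) U (𝓝 ‖(fderiv ℂ π x).det‖) :=
        (((differentiableOn_det_fderiv hD.1 hπ.holomorphic).continuousOn.continuousAt
          (hD.1.mem_nhds hxD)).tendsto.comp hx).norm
      have h2 : η ≤ ‖(fderiv ℂ π x).det‖ := by
        refine ge_of_tendsto h1 ?_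
        filter_upwards [hUS] with w hw using (hf w hw).2.2
      rw [h0, norm_zero] at h2
      linarith
  obtain ⟨x, hxD, hxz, hxd, hxl⟩ := hlim a fun w hw =>
    ⟨(h.mem_left hw.1).1, (h.mem_left hw.1).2, hw.2.1⟩
  obtain ⟨y, hyD, hyz, hyd, hyl⟩ := hlim b fun w hw =>
    ⟨(h.mem_right hw.1).1, (h.mem_right hw.1).2, hw.2.2⟩
  obtain ⟨A, hA0, hA, hA'⟩ := exists_local_section hD.1 hπ.holomorphic hxD hxd
  -- Equal limits contradict local injectivity of π at x. Distinct limits give three different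
  -- points z, x, y over π z, hence three points z', A (π z'), B (π z') in one regular fibre.
  by_cases hxy : x = y
  · subst hxy
    obtain ⟨w, hw, hw1, hw2⟩ := (hUS.and ((hxl.eventually hA').and (hyl.eventually hA'))).exists
    rw [(h.mem_left hw.1).2] at hw1
    rw [(h.mem_right hw.1).2] at hw2
    exact (h w hw.1).1 (hw1.symm.trans hw2)
  · obtain ⟨B, hB0, hB, -⟩ := exists_local_section hD.1 hπ.holomorphic hyD hyd
    rw [hxz] at hA0 hA
    rw [hyz] at hB0 hB
    have hzx : z ≠ x := fun hzx => hxd (hzx ▸ hz.2)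
    have hzy : z ≠ y := fun hzy => hyd (hzy ▸ hz.2)
    have hπz : Tendsto π (𝓝 z) (𝓝 (π z)) :=
      hπ.holomorphic.continuousOn.continuousAt (hD.1.mem_nhds hz.1)
    have hAl : Tendsto (fun z' => A (π z')) (𝓝 z) (𝓝 x) := by
      have := hA.self_of_nhds.1.continuousAt.tendsto.comp hπz
      rwa [hA0] at this
    have hBl : Tendsto (fun z' => B (π z')) (𝓝 z) (𝓝 y) := by
      have := hB.self_of_nhds.1.continuousAt.tendsto.comp hπz
      rwa [hB0] at this
    obtain ⟨z', ⟨hz'D, hz'G⟩, h1, h2, h3, h4, h5⟩ :=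
      ((hπ.frequently_regular hD hG hz.1).and_eventually
      ((eventually_ne_of_tendsto hAl hBl hxy).and ((eventually_ne_of_tendsto tendsto_id hAl hzx).and
      ((eventually_ne_of_tendsto tendsto_id hBl hzy).and ((hπz.eventually hA).and
        (hπz.eventually hB)))))).exists
    simp only [id] at h2 h3
    have e1 := h.eq_or_eq hz'G hz'D rfl
    have e2 := h.eq_or_eq hz'G h4.2.1 h4.2.2
    have e3 := h.eq_or_eq hz'G h5.2.1 h5.2.2
    grind

end IsFibrePair

namespace IsFibrePair

variable {a b : Cn n → Cn n} {w : Cn n}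

/-- A continuous function on `G` that vanishes exactly at the critical values of `π` and is
holomorphic at the regular ones. -/
theorem exists_defining_function (h : IsFibrePair D G π a b) (hD : IsDom D) (hG : IsOpen G)
    (hπ : IsMProper 2 D G π) :
    ∃ δ : Cn n → ℂ, (∀ w, δ w ≠ 0 ↔ w ∈ G \ π '' locus D π) ∧ ContinuousOn δ G ∧
      ∀ w ∈ G, δ w ≠ 0 → DifferentiableAt ℂ δ w := by
  classical
  have hπp := hπ.toIsProperHolomorphic
  set J : Cn n → ℂ := fun z => (fderiv ℂ π z).det with hJ
  have hJd : DifferentiableOn ℂ J D := differentiableOn_det_fderiv hD.1 hπ.holomorphic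
  set δ : Cn n → ℂ := fun w => if w ∈ G \ π '' locus D π then J (a w) * J (b w) else 0 with hδ
  have hδ0 : ∀ w, δ w ≠ 0 ↔ w ∈ G \ π '' locus D π := fun w => by
    by_cases hw : w ∈ G \ π '' locus D π
    · have ha := h.mem_left hw
      have hb := h.mem_right hw
      have := mul_ne_zero (det_ne_zero hw ha.1 ha.2) (det_ne_zero hw hb.1 hb.2)
      simp only [hδ, if_pos hw]
      exact iff_of_true this hw
    · simp only [hδ, if_neg hw, ne_eq, not_true_eq_false, hw]
  have hd : ∀ w ∈ G \ π '' locus D π, DifferentiableAt ℂ δ w := fun w hw => by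
    have ha := h.mem_left hw
    have hb := h.mem_right hw
    have h1 : DifferentiableAt ℂ (fun p : Cn n × Cn n => J p.1 * J p.2) (a w, b w) := by
      have h2 : DifferentiableAt ℂ (fun p : Cn n × Cn n => J p.1) (a w, b w) :=
        DifferentiableAt.comp (g := J) (a w, b w) (hJd.differentiableAt (hD.1.mem_nhds ha.1))
          differentiableAt_fst
      have h3 : DifferentiableAt ℂ (fun p : Cn n × Cn n => J p.2) (a w, b w) :=
        DifferentiableAt.comp (g := J) (a w, b w) (hJd.differentiableAt (hD.1.mem_nhds hb.1))
          differentiableAt_snd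
      exact h2.mul h3
    have h4 := h.differentiableAt_symmetric hD.1 hG hπp hw (s := fun x y => J x * J y)
      (fun x y => mul_comm _ _) h1
    refine h4.congr_of_eventuallyEq ?_
    filter_upwards [(isOpen_regularValues hD.1 hG hπp).mem_nhds hw] with x hx
    simp only [hδ, if_pos hx]
  refine ⟨δ, hδ0, fun w hw => ContinuousAt.continuousWithinAt ?_,
    fun w _ hw => hd w ((hδ0 w).1 hw)⟩
  by_cases hwE : w ∈ G \ π '' locus D π
  · exact (hd w hwE).continuousAt
  have hδw : δ w = 0 := by simp only [hδ, if_neg hwE]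
  obtain ⟨z, hz, rfl⟩ : w ∈ π '' locus D π := by
    by_contra hne
    exact hwE ⟨hw, hne⟩
  -- Near a critical value one factor of the product is small and the other is bounded on K.
  obtain ⟨K, hKD, hK, hKev⟩ := hπp.exists_compact_fibre_subset hG hw
  obtain ⟨M, hM⟩ := hK.exists_bound_of_continuousOn (hJd.continuousOn.mono hKD)
  have hM' : ∀ x ∈ K, ‖J x‖ ≤ |M| + 1 := fun x hx =>
    (hM x hx).trans ((le_abs_self M).trans (by linarith))
  rw [ContinuousAt, hδw, Metric.tendsto_nhds]
  intro ε hε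
  have hη : 0 < ε / (|M| + 1) := by positivity
  have hMpos : 0 < |M| + 1 := by positivity
  filter_upwards [h.eventually_small_det hD hG hπ hz hη, hKev] with x hx hxK
  rw [dist_zero_right]
  by_cases hxE : x ∈ G \ π '' locus D π
  · have ha := h.mem_left hxE
    have hb := h.mem_right hxE
    have haM := hM' _ (hxK _ ha.1 ha.2)
    have hbM := hM' _ (hxK _ hb.1 hb.2)
    simp only [hδ, if_pos hxE, norm_mul]
    rcases hx hxE with hx | hx
    · calc ‖J (a x)‖ * ‖J (b x)‖ ≤ ‖J (a x)‖ * (|M| + 1) := by gcongr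
        _ < ε / (|M| + 1) * (|M| + 1) := by gcongr
        _ = ε := div_mul_cancel₀ _ hMpos.ne'
    · calc ‖J (a x)‖ * ‖J (b x)‖ ≤ (|M| + 1) * ‖J (b x)‖ := by gcongr
        _ < (|M| + 1) * (ε / (|M| + 1)) := by gcongr
        _ = ε := mul_div_cancel₀ _ hMpos.ne'
  · simp only [hδ, if_neg hxE, norm_zero]
    exact hε

end IsFibrePair

/-! ### Extension across the critical values. -/

namespace IsMProper

variable {F : Type*} [NormedAddCommGroup F] [NormedSpace ℂ F]

/-- Functions that are holomorphic and locally bounded off the critical values of `π` extend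
holomorphically. -/
theorem exists_extension [CompleteSpace F] (hπ : IsMProper 2 D G π) (hD : IsDom D) (hG : IsOpen G)
    {W : Set (Cn n)} (hW : IsOpen W) (hWG : W ⊆ G) {f : Cn n → F}
    (hf : ∀ w ∈ W, w ∈ G \ π '' locus D π → DifferentiableAt ℂ f w)
    (hb : ∀ w ∈ W, ∃ M : ℝ, ∀ᶠ w' in 𝓝 w, w' ∈ G \ π '' locus D π → ‖f w'‖ ≤ M) :
    ∃ F₀ : Cn n → F, DifferentiableOn ℂ F₀ W ∧
      ∀ w ∈ W, w ∈ G \ π '' locus D π → F₀ w = f w := by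
  obtain ⟨a, b, h⟩ := hπ.exists_isFibrePair
  obtain ⟨δ, hδ0, hδ, hδd⟩ := h.exists_defining_function hD hG hπ
  simp only [← hδ0] at hf hb ⊢
  refine exists_extension_of_bounded_off_zeros hW (hδ.mono hWG) (fun w hw => hδd w (hWG hw))
    (fun w hw => ?_) hf hb
  simp only [hδ0]
  exact mem_closure_iff_frequently.2
    (frequently_regularValues hD.1 hG hπ.toIsProperHolomorphic (hWG hw))

theorem eq_of_eq_on_regular {X : Type*} [TopologicalSpace X] [T2Space X] (hπ : IsMProper 2 D G π)
    (hD : IsDom D) (hG : IsOpen G) {f₁ f₂ : Cn n → X} {z : Cn n} (hz : z ∈ D)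
    (h₁ : ContinuousAt f₁ z) (h₂ : ContinuousAt f₂ z)
    (h : ∀ᶠ x in 𝓝 z, x ∈ D → π x ∈ G \ π '' locus D π → f₁ x = f₂ x) : f₁ z = f₂ z := by
  by_contra hne
  obtain ⟨x, hx, hx1, hx2⟩ := ((hπ.frequently_regular hD hG hz).and_eventually
    (h.and (eventually_ne_of_tendsto h₁ h₂ hne))).exists
  exact hx2 (hx1 hx.1 hx.2)

end IsMProper

/-- Symmetric functions of the two points of the fibre extend holomorphically. -/
theorem IsFibrePair.exists_symmetric_extension {F : Type*} [NormedAddCommGroup F] [NormedSpace ℂ F]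
    [CompleteSpace F] {a b : Cn n → Cn n} (h : IsFibrePair D G π a b) (hD : IsDom D)
    (hG : IsOpen G) (hπ : IsMProper 2 D G π) {s : Cn n → Cn n → F} (hs : ∀ x y, s x y = s y x)
    (hd : Differentiable ℂ (fun p : Cn n × Cn n => s p.1 p.2)) :
    ∃ S : Cn n → F, DifferentiableOn ℂ S G ∧
      ∀ w ∈ G \ π '' locus D π, S w = s (a w) (b w) := by
  have hπp := hπ.toIsProperHolomorphic
  obtain ⟨S, hS, hS'⟩ := hπ.exists_extension hD hG hG subset_rfl (f := fun w => s (a w) (b w))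
    (fun w _ hw => h.differentiableAt_symmetric hD.1 hG hπp hw hs (hd _)) (fun w hw => by
      obtain ⟨K, hKD, hK, hKev⟩ := hπp.exists_compact_fibre_subset hG hw
      obtain ⟨M, hM⟩ := (hK.prod hK).exists_bound_of_continuousOn hd.continuous.continuousOn
      refine ⟨M, ?_⟩
      filter_upwards [hKev] with x hx hxE
      have ha := h.mem_left hxE
      have hb := h.mem_right hxE
      exact hM (a x, b x) ⟨hx _ ha.1 ha.2, hx _ hb.1 hb.2⟩)
  exact ⟨S, hS, fun w hw => hS' w hw.1 hw⟩

/-! ### The sheet involution and its fixed points. -/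

/-- `γ` is the holomorphic involution of `D` that exchanges the two sheets of `π`. -/
structure IsSheetInvolution (D G : Set (Cn n)) (π γ : Cn n → Cn n) : Prop where
  differentiableOn : DifferentiableOn ℂ γ D
  mapsTo : MapsTo γ D D
  involutive : ∀ z ∈ D, γ (γ z) = z
  map_eq : ∀ z ∈ D, π (γ z) = π z
  ne_of_regular : ∀ z ∈ D, π z ∈ G \ π '' locus D π → γ z ≠ z
  eq_or_eq : ∀ z ∈ D, ∀ z' ∈ D, π z' = π z → z' = z ∨ z' = γ z

/-- The symmetric product of two nonzero vectors is nonzero. This replaces the factorisation of a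
quadratic polynomial when the fibre points are vectors. -/
theorem eq_zero_or_eq_zero_of_symm_mul {ι K : Type*} [Field K] [CharZero K] {u v : ι → K}
    (h : ∀ i j, u i * v j + u j * v i = 0) : u = 0 ∨ v = 0 := by
  by_contra! hne
  obtain ⟨i, hi⟩ := Function.ne_iff.1 hne.1
  obtain ⟨j, hj⟩ := Function.ne_iff.1 hne.2
  have h1 : v i = 0 := by
    have := h i i
    rw [← two_mul, mul_eq_zero, mul_eq_zero (a := u i)] at this
    exact (this.resolve_left two_ne_zero).resolve_left hi
  have h2 := h i j
  rw [h1, mul_zero, add_zero, mul_eq_zero] at h2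
  exact h2.elim hi hj

theorem IsMProper.exists_isSheetInvolution (hπ : IsMProper 2 D G π) (hD : IsDom D)
    (hG : IsOpen G) : ∃ γ, IsSheetInvolution D G π γ := by
  obtain ⟨a, b, h⟩ := hπ.exists_isFibrePair
  have hπp := hπ.toIsProperHolomorphic
  obtain ⟨σ, hσ, hσ'⟩ := h.exists_symmetric_extension hD hG hπ (s := fun x y => x + y)
    add_comm (by fun_prop)
  have hP : ∀ i j : Fin n, ∃ S : Cn n → ℂ, DifferentiableOn ℂ S G ∧
      ∀ w ∈ G \ π '' locus D π, S w = a w i * b w j + a w j * b w i := fun i j =>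
    h.exists_symmetric_extension hD hG hπ (s := fun x y => x i * y j + x j * y i)
      (fun x y => by ring) (by fun_prop)
  set γ : Cn n → Cn n := fun z => σ (π z) - z with hγ
  have hγd : DifferentiableOn ℂ γ D :=
    (hσ.comp hπ.holomorphic hπ.mapsTo).sub differentiableOn_id
  have hγc : ∀ z ∈ D, ContinuousAt γ z := fun z hz =>
    hγd.continuousOn.continuousAt (hD.1.mem_nhds hz)
  have hπc : ∀ z ∈ D, ContinuousAt π z := fun z hz =>
    hπ.holomorphic.continuousOn.continuousAt (hD.1.mem_nhds hz)
  have hreg : ∀ z ∈ D, π z ∈ G \ π '' locus D π →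
      (z = a (π z) ∧ γ z = b (π z)) ∨ (z = b (π z) ∧ γ z = a (π z)) := by
    intro z hz hw
    rcases h.eq_or_eq hw hz rfl with hza | hzb
    · refine Or.inl ⟨hza, ?_⟩
      simp only [hγ, hσ' _ hw]
      nth_rewrite 3 [hza]
      abel
    · refine Or.inr ⟨hzb, ?_⟩
      simp only [hγ, hσ' _ hw]
      nth_rewrite 3 [hzb]
      abel
  have hregD : ∀ z ∈ D, π z ∈ G \ π '' locus D π → γ z ∈ D ∧ π (γ z) = π z := by
    intro z hz hw
    rcases hreg z hz hw with h1 | h1 <;> rw [h1.2]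
    · exact h.mem_right hw
    · exact h.mem_left hw
  have hmaps : MapsTo γ D D := by
    intro z hz
    obtain ⟨K, hKD, hK, hKev⟩ := hπp.exists_compact_fibre_subset hG (hπ.mapsTo hz)
    -- At regular points near z the value of γ lies in the compact K ⊆ D, so the limit γ z cannot
    -- leave D.
    refine hKD (hK.isClosed.mem_of_frequently_of_tendsto ?_ (hγc z hz))
    refine ((hπ.frequently_regular hD hG hz).and_eventually ((hπc z hz).eventually hKev)).mono ?_
    rintro x ⟨hx, hxK⟩
    have := hregD x hx.1 hx.2
    exact hxK _ this.1 this.2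
  have hmap : ∀ z ∈ D, π (γ z) = π z := fun z hz =>
    hπ.eq_of_eq_on_regular hD hG hz (f₁ := fun z => π (γ z))
      (ContinuousAt.comp (hπc _ (hmaps hz)) (hγc z hz)) (hπc z hz)
      (Eventually.of_forall fun x hx hxw => (hregD x hx hxw).2)
  have hinv : ∀ z ∈ D, γ (γ z) = z := fun z hz => by
    change σ (π (γ z)) - γ z = z
    rw [hmap z hz]
    simp only [hγ, sub_sub_cancel]
  refine ⟨γ, hγd, hmaps, hinv, hmap, fun z hz hw heq => ?_, fun z hz z' hz' hzz' => ?_⟩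
  · have hne := (h _ hw).1
    rcases hreg z hz hw with h1 | h1
    · exact hne (h1.1.symm.trans (heq.symm.trans h1.2))
    · exact hne (h1.2.symm.trans (heq.trans h1.1))
  · choose P hPd hP using hP
    have hPz : ∀ i j, ∀ z ∈ D, P i j (π z) = z i * γ z j + z j * γ z i := by
      intro i j z hz
      have hc : ∀ i : Fin n, ContinuousAt (fun x : Cn n => x i) z := fun i => by fun_prop
      have hc' : ∀ i : Fin n, ContinuousAt (fun x : Cn n => γ x i) z := fun i =>
        ContinuousAt.comp (g := fun x : Cn n => x i) (by fun_prop) (hγc z hz)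
      refine hπ.eq_of_eq_on_regular hD hG hz (f₁ := fun z => P i j (π z))
        (f₂ := fun z => z i * γ z j + z j * γ z i) ?_
        (((hc i).mul (hc' j)).add ((hc j).mul (hc' i))) ?_
      · exact ContinuousAt.comp ((hPd i j).continuousOn.continuousAt
          (hG.mem_nhds (hπ.mapsTo hz))) (hπc z hz)
      · refine Eventually.of_forall fun x hx hxw => ?_
        simp only [hP i j _ hxw]
        rcases hreg x hx hxw with h1 | h1 <;> rw [h1.2, ← h1.1]
        ring
    have hsum : ∀ i, z' i + γ z' i = z i + γ z i := fun i => by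
      simp only [hγ, hzz', PiLp.sub_apply]
      ring
    -- The vector form of (z' - z)(z' - γ z) = 0: z' and γ z' have the same sum and the same
    -- symmetric products as z and γ z.
    have key : ∀ i j, (z' i - z i) * (z' j - γ z j) + (z' j - z j) * (z' i - γ z i) = 0 := by
      intro i j
      have h1 := hPz i j z hz
      have h2 := hPz i j z' hz'
      rw [hzz', h1] at h2
      have h3 : γ z' i = z i + γ z i - z' i := by rw [← hsum]; ring
      have h4 : γ z' j = z j + γ z j - z' j := by rw [← hsum]; ring
      rw [h3, h4] at h2
      linear_combination h2
    refine (eq_zero_or_eq_zero_of_symm_mul key).imp (fun h0 => ?_) fun h0 => ?_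
    · ext i
      exact sub_eq_zero.1 (congrFun h0 i)
    · ext i
      exact sub_eq_zero.1 (congrFun h0 i)

theorem IsSheetInvolution.eq_self_of_mem_locus {γ : Cn n → Cn n} (hγ : IsSheetInvolution D G π γ)
    (hπ : IsMProper 2 D G π) (hD : IsDom D) (hG : IsOpen G) {z₀ : Cn n}
    (hz₀ : z₀ ∈ locus D π) : γ z₀ = z₀ := by
  classical
  by_contra hne
  obtain ⟨a, b, h⟩ := hπ.exists_isFibrePair
  have hπp := hπ.toIsProperHolomorphic
  have hγc := hγ.differentiableOn.continuousOn
  obtain ⟨U, V, hU, hV, hzU, hzV, hUV⟩ := t2_separation (Ne.symm hne)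
  set N₁ : Set (Cn n) := (D ∩ γ ⁻¹' V) ∩ U with hN₁
  set N₂ : Set (Cn n) := (D ∩ γ ⁻¹' U) ∩ V with hN₂
  have hN₁o : IsOpen N₁ := (hγc.isOpen_inter_preimage hD.1 hV).inter hU
  have hN₂o : IsOpen N₂ := (hγc.isOpen_inter_preimage hD.1 hU).inter hV
  have hdisj : ∀ z, z ∈ N₂ → z ∉ N₁ := fun z h2 h1 => disjoint_left.1 hUV h1.2 h2.2
  have h12 : ∀ z ∈ N₁, γ z ∈ N₂ := fun z hz =>
    ⟨⟨hγ.mapsTo hz.1.1, by rw [mem_preimage, hγ.involutive z hz.1.1]; exact hz.2⟩, hz.1.2⟩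
  have h21 : ∀ z ∈ N₂, γ z ∈ N₁ := fun z hz =>
    ⟨⟨hγ.mapsTo hz.1.1, by rw [mem_preimage, hγ.involutive z hz.1.1]; exact hz.2⟩, hz.1.2⟩
  have hz₀N : z₀ ∈ N₁ := ⟨⟨hz₀.1, hzV⟩, hzU⟩
  have hfib := hπp.eventually_fibre_subset hG (hπ.mapsTo hz₀.1) (hN₁o.union hN₂o)
    fun z hz hzw => by
      rcases hγ.eq_or_eq z₀ hz₀.1 z hz hzw with rfl | rfl
      · exact Or.inl hz₀N
      · exact Or.inr (h12 _ hz₀N)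
  obtain ⟨W, hW, hWo, hzW⟩ := _root_.eventually_nhds_iff.1
    (hfib.and (hG.mem_nhds (hπ.mapsTo hz₀.1)))
  -- Since γ exchanges the disjoint sets N₁ and N₂, each regular fibre near π z₀ has exactly one
  -- point in N₁, and A selects it.
  set A : Cn n → Cn n := fun w => if a w ∈ N₁ then a w else b w with hA
  have hγab : ∀ w ∈ G \ π '' locus D π, γ (a w) = b w := fun w hw => by
    have ha := h.mem_left hw
    have h1 := h.eq_or_eq hw (hγ.mapsTo ha.1) ((hγ.map_eq _ ha.1).trans ha.2)
    refine h1.resolve_left (hγ.ne_of_regular _ ha.1 ?_)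
    rwa [ha.2]
  have hcases : ∀ w ∈ W, w ∈ G \ π '' locus D π →
      (a w ∈ N₁ ∧ b w ∈ N₂) ∨ (a w ∈ N₂ ∧ b w ∈ N₁) := fun w hw hwE => by
    have ha := h.mem_left hwE
    rw [← hγab w hwE]
    exact ((hW w hw).1 _ ha.1 ha.2).imp (fun h1 => ⟨h1, h12 _ h1⟩) fun h1 => ⟨h1, h21 _ h1⟩
  have hAd : ∀ w ∈ W, w ∈ G \ π '' locus D π → DifferentiableAt ℂ A w := by
    intro w hw hwE
    obtain ⟨A₁, B₁, hA0, hB0, hA₁, hB₁, hAB⟩ := h.exists_branches hD.1 hG hπp hwE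
    rcases hcases w hw hwE with hc | hc
    · refine hA₁.congr_of_eventuallyEq ?_
      have e1 := hA₁.continuousAt.eventually (hN₁o.mem_nhds (by rw [hA0]; exact hc.1))
      have e2 := hB₁.continuousAt.eventually (hN₂o.mem_nhds (by rw [hB0]; exact hc.2))
      filter_upwards [e1, e2, hAB] with x hx1 hx2 hx
      have := hdisj _ hx2
      rcases hx with hx | hx <;> simp only [hA, hx.1, hx.2]
      · exact if_pos hx1
      · exact if_neg this
    · refine hB₁.congr_of_eventuallyEq ?_
      have e1 := hA₁.continuousAt.eventually (hN₂o.mem_nhds (by rw [hA0]; exact hc.1))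
      have e2 := hB₁.continuousAt.eventually (hN₁o.mem_nhds (by rw [hB0]; exact hc.2))
      filter_upwards [e1, e2, hAB] with x hx1 hx2 hx
      have := hdisj _ hx1
      rcases hx with hx | hx <;> simp only [hA, hx.1, hx.2]
      · exact if_neg this
      · exact if_pos hx2
  obtain ⟨T, hT, hTA⟩ := hπ.exists_extension hD hG hWo (fun w hw => (hW w hw).2) hAd
    (fun w hw => by
      obtain ⟨K, hKD, hK, hKev⟩ := hπp.exists_compact_fibre_subset hG (hW w hw).2
      obtain ⟨M, hM⟩ := hK.exists_bound_of_continuousOn continuousOn_id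
      refine ⟨M, ?_⟩
      filter_upwards [hKev] with x hx hxE
      have ha := h.mem_left hxE
      have hb := h.mem_right hxE
      simp only [hA]
      split_ifs
      · exact hM _ (hx _ ha.1 ha.2)
      · exact hM _ (hx _ hb.1 hb.2))
  have hπc : ∀ z ∈ D, ContinuousAt π z := fun z hz =>
    hπ.holomorphic.continuousOn.continuousAt (hD.1.mem_nhds hz)
  have hN : ∀ᶠ z in 𝓝 z₀, z ∈ N₁ ∧ π z ∈ W :=
    Filter.Eventually.and (hN₁o.mem_nhds hz₀N) ((hπc z₀ hz₀.1).eventually (hWo.mem_nhds hzW))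
  have hleft : ∀ᶠ z in 𝓝 z₀, T (π z) = z := by
    filter_upwards [hN.eventually_nhds] with z hz
    have hzD : z ∈ D := hz.self_of_nhds.1.1.1
    refine hπ.eq_of_eq_on_regular hD hG hzD (f₁ := fun z => T (π z)) (f₂ := id)
      (ContinuousAt.comp (hT.continuousOn.continuousAt (hWo.mem_nhds hz.self_of_nhds.2))
        (hπc z hzD)) continuousAt_id ?_
    filter_upwards [hz] with x hx hxD hxE
    simp only [hTA _ hx.2 hxE, hA, id]
    rcases hcases _ hx.2 hxE with hc | hc
    · rw [if_pos hc.1]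
      exact ((h.eq_or_eq hxE hxD rfl).resolve_right
        fun h1 => hdisj _ hc.2 (h1 ▸ hx.1)).symm
    · rw [if_neg (hdisj _ hc.1)]
      exact ((h.eq_or_eq hxE hxD rfl).resolve_left
        fun h1 => hdisj _ hc.1 (h1 ▸ hx.1)).symm
  -- The chain rule for T ∘ π = id near z₀ would make det π'(z₀) nonzero.
  have hd1 := (hT.differentiableAt (hWo.mem_nhds hzW)).hasFDerivAt.comp z₀
    (hπ.holomorphic.differentiableAt (hD.1.mem_nhds hz₀.1)).hasFDerivAt
  have hd2 : HasFDerivAt (T ∘ π) (ContinuousLinearMap.id ℂ (Cn n)) z₀ :=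
    (hasFDerivAt_id z₀).congr_of_eventuallyEq hleft
  have hcomp := congrArg ContinuousLinearMap.det (hd1.unique hd2)
  have hdet0 : LinearMap.det (fderiv ℂ π z₀ : Cn n →ₗ[ℂ] Cn n) = 0 := hz₀.2
  rw [ContinuousLinearMap.det, ContinuousLinearMap.det, ContinuousLinearMap.toLinearMap_comp,
    LinearMap.det_comp, hdet0, mul_zero] at hcomp
  simp at hcomp

/-! ### The deck group. -/

/-- The automorphism of `D` given by the sheet involution. -/
noncomputable def IsSheetInvolution.aut {γ : Cn n → Cn n} (hγ : IsSheetInvolution D G π γ) :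
    Aut D :=
  ⟨⟨fun z => ⟨γ z, hγ.mapsTo z.2⟩, fun z => ⟨γ z, hγ.mapsTo z.2⟩,
      fun z => Subtype.ext (hγ.involutive z z.2), fun z => Subtype.ext (hγ.involutive z z.2)⟩,
    ⟨γ, hγ.differentiableOn, fun _ => rfl⟩, ⟨γ, hγ.differentiableOn, fun _ => rfl⟩⟩

namespace IsSheetInvolution

variable {γ : Cn n → Cn n}

theorem coe_aut_apply (hγ : IsSheetInvolution D G π γ) (z : D) : (hγ.aut.1 z : Cn n) = γ z := rfl

theorem aut_mul_self (hγ : IsSheetInvolution D G π γ) : hγ.aut * hγ.aut = 1 :=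
  Subtype.ext (Equiv.ext fun z => Subtype.ext (hγ.involutive z z.2))

theorem aut_mem_deck (hγ : IsSheetInvolution D G π γ) : hγ.aut ∈ Deck D π :=
  fun z => hγ.map_eq z z.2

theorem aut_ne_one (hγ : IsSheetInvolution D G π γ) (hπ : IsMProper 2 D G π) (hD : IsDom D)
    (hG : IsOpen G) : hγ.aut ≠ 1 := by
  intro h
  obtain ⟨z, hz⟩ := hD.2.nonempty
  obtain ⟨x, hx, hxw⟩ := (hπ.frequently_regular hD hG hz).exists
  refine hγ.ne_of_regular x hx hxw ?_
  rw [← hγ.coe_aut_apply ⟨x, hx⟩, h]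
  rfl

theorem isGaloisMap (hγ : IsSheetInvolution D G π γ) : IsGaloisMap D G π := by
  rintro w - z z' rfl hz'
  rcases hγ.eq_or_eq z z.2 z' z'.2 hz' with h | h
  · exact ⟨1, one_mem _, Subtype.ext h.symm⟩
  · exact ⟨hγ.aut, hγ.aut_mem_deck, Subtype.ext h.symm⟩

/-- A deck automorphism other than the identity moves some point, hence all nearby points. There it
can only be γ, and the identity theorem spreads this over D. -/
theorem deck_eq (hγ : IsSheetInvolution D G π γ) (hD : IsDom D) :
    (Deck D π : Set (Aut D)) = {1, hγ.aut} := by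
  refine Subset.antisymm (fun ρ hρ => ?_) ?_
  · rw [mem_insert_iff, mem_singleton_iff, or_iff_not_imp_left]
    intro hne
    obtain ⟨F, hF, hFρ⟩ := ρ.2.1
    obtain ⟨z, hz⟩ : ∃ z : D, ρ.1 z ≠ z := by
      by_contra! h
      exact hne (Subtype.ext (Equiv.ext h))
    have hzF : F z ≠ z := by
      rw [hFρ]
      exact fun h => hz (Subtype.ext h)
    have hev : (fun x => F x - γ x) =ᶠ[𝓝 (z : Cn n)] 0 := by
      filter_upwards [hD.1.mem_nhds z.2, eventually_ne_of_tendsto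
        (hF.continuousOn.continuousAt (hD.1.mem_nhds z.2)) tendsto_id hzF] with x hx hxF
      have h1 := hFρ ⟨x, hx⟩
      have h2 := hγ.eq_or_eq x hx (F x) (by rw [h1]; exact Subtype.coe_prop _)
        (by rw [h1]; exact hρ ⟨x, hx⟩)
      exact sub_eq_zero.2 (h2.resolve_left hxF)
    have heq := eqOn_zero_of_eventuallyEq_zero hD.1 hD.2.isPreconnected
      (hF.sub hγ.differentiableOn) z.2 hev
    refine Subtype.ext (Equiv.ext fun x => Subtype.ext ?_)
    rw [hγ.coe_aut_apply, ← hFρ]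
    exact sub_eq_zero.1 (heq x.2)
  · rintro ρ (rfl | rfl)
    · exact one_mem _
    · exact hγ.aut_mem_deck

end IsSheetInvolution

/-! ### The quotient by the deck group. -/

/-- The map `D/Deck(π) → G` induced by `π`. -/
def IsProperHolomorphic.quotientMap (hπ : IsProperHolomorphic D G π) :
    OrbitSpace (Deck D π) → G :=
  Quotient.lift (fun z : D => (⟨π z, hπ.mapsTo z.2⟩ : G)) (by
    rintro z z' ⟨ρ, rfl⟩
    exact Subtype.ext (ρ.2 z'))

theorem IsProperHolomorphic.isClosedMap (hπ : IsProperHolomorphic D G π) (hG : IsOpen G) :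
    IsClosedMap fun z : D => (⟨π z, hπ.mapsTo z.2⟩ : G) := by
  intro C hC
  obtain ⟨C', hC', rfl⟩ := isClosed_induced_iff.1 hC
  rw [← isOpen_compl_iff, isOpen_iff_eventually]
  intro w hw
  have h := hπ.eventually_fibre_subset hG w.2 hC'.isOpen_compl fun z hz hzw hzC =>
    hw ⟨⟨z, hz⟩, hzC, Subtype.ext hzw⟩
  filter_upwards [continuous_subtype_val.continuousAt.eventually h] with w' hw'
  rintro ⟨z, hz, rfl⟩
  exact hw' z z.2 rfl hz

theorem IsProperHolomorphic.continuous_quotientMap (hπ : IsProperHolomorphic D G π) :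
    Continuous hπ.quotientMap :=
  Continuous.quotient_lift (hπ.holomorphic.continuousOn.domRestrict.subtype_mk _) _

theorem IsProperHolomorphic.isClosedMap_quotientMap (hπ : IsProperHolomorphic D G π)
    (hG : IsOpen G) : IsClosedMap hπ.quotientMap := by
  intro C hC
  have h := hπ.isClosedMap hG _ (hC.preimage (continuous_quotient_mk' (s := MulAction.orbitRel _ D)))
  convert h using 1
  ext w
  constructor
  · rintro ⟨x, hx, rfl⟩
    induction x using Quotient.inductionOn with
    | h z => exact ⟨z, hx, rfl⟩
  · rintro ⟨z, hz, rfl⟩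
    exact ⟨_, hz, rfl⟩

theorem IsGaloisMap.injective_quotientMap (h : IsGaloisMap D G π)
    (hπ : IsProperHolomorphic D G π) : Function.Injective hπ.quotientMap := by
  intro x y
  induction x using Quotient.inductionOn with
  | h z =>
    induction y using Quotient.inductionOn with
    | h z' =>
      intro heq
      have heq' : π z = π z' := congrArg Subtype.val heq
      obtain ⟨ρ, hρ, hρz⟩ := h (π z') (hπ.mapsTo z'.2) z' z rfl heq'
      exact Quotient.sound ⟨⟨ρ, hρ⟩, hρz⟩

theorem IsMProper.surjective_quotientMap (hπ : IsMProper 2 D G π) (hD : IsOpen D)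
    (hG : IsOpen G) : Function.Surjective hπ.toIsProperHolomorphic.quotientMap := by
  intro w
  obtain ⟨z, hz, hzw⟩ := hπ.exists_mem_fibre hD hG w.2
  exact ⟨OrbitSpace.proj _ ⟨z, hz⟩, Subtype.ext hzw⟩

/-- A function on an open subset of `G` is holomorphic if its pull-back along `π` is. -/
theorem IsMProper.exists_differentiableOn_of_comp (hπ : IsMProper 2 D G π) (hD : IsDom D)
    (hG : IsOpen G) {W : Set (Cn n)} (hW : IsOpen W) (hWG : W ⊆ G) {f H : Cn n → ℂ}
    (hH : DifferentiableOn ℂ H (D ∩ π ⁻¹' W)) (hf : ∀ z ∈ D, π z ∈ W → H z = f (π z)) :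
    ∃ F : Cn n → ℂ, DifferentiableOn ℂ F W ∧ ∀ w ∈ W, F w = f w := by
  have hπp := hπ.toIsProperHolomorphic
  have hV : IsOpen (D ∩ π ⁻¹' W) := hπ.holomorphic.continuousOn.isOpen_inter_preimage hD.1 hW
  -- Continuity of f descends from H because fibres over nearby points stay in the open set where H
  -- takes values in the prescribed neighbourhood.
  have hfc : ∀ w ∈ W, ContinuousAt f w := by
    intro w hw S hS
    obtain ⟨S', hS', hSo, hwS⟩ := _root_.mem_nhds_iff.1 hS
    change ∀ᶠ x in 𝓝 w, f x ∈ S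
    have hN := hH.continuousOn.isOpen_inter_preimage hV hSo
    filter_upwards [hW.mem_nhds hw, hπp.eventually_fibre_subset hG (hWG hw) hN fun z hz hzw =>
      ⟨⟨hz, by rwa [mem_preimage, hzw]⟩, by
        rw [mem_preimage, hf z hz (by rwa [hzw]), hzw]; exact hwS⟩] with x hx hxN
    obtain ⟨z, hz, hzx⟩ := hπ.exists_mem_fibre hD.1 hG (hWG hx)
    have := (hxN z hz hzx).2
    rw [mem_preimage, hf z hz (by rwa [hzx]), hzx] at this
    exact hS' this
  have hfd : ∀ w ∈ W, w ∈ G \ π '' locus D π → DifferentiableAt ℂ f w := by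
    intro w hw hwE
    obtain ⟨z, hz, rfl⟩ := hπ.exists_mem_fibre hD.1 hG (hWG hw)
    obtain ⟨A, hAz, hA, -⟩ := exists_local_section hD.1 hπ.holomorphic hz
      (IsFibrePair.det_ne_zero hwE hz rfl)
    have hHz : DifferentiableAt ℂ H (A (π z)) := by
      rw [hAz]
      exact hH.differentiableAt (hV.mem_nhds ⟨hz, hw⟩)
    refine (hHz.comp _ hA.self_of_nhds.1).congr_of_eventuallyEq ?_
    filter_upwards [hA, hW.mem_nhds hw] with x hx hxW
    rw [Function.comp_apply, hf _ hx.2.1 (by rwa [hx.2.2]), hx.2.2]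
  obtain ⟨F, hF, hFf⟩ := hπ.exists_extension hD hG hW hWG hfd fun w hw => by
    refine ⟨‖f w‖ + 1, ?_⟩
    filter_upwards [(hfc w hw).norm.eventually (gt_mem_nhds (lt_add_one _))] with x hx _
      using hx.le
  refine ⟨F, hF, fun w hw => ?_⟩
  -- F and f are both continuous and agree at the dense regular values, so they agree at critical
  -- values too.
  by_contra hne
  obtain ⟨x, hx, hxW, hxne⟩ := ((frequently_regularValues hD.1 hG hπp (hWG hw)).and_eventually
    (Filter.Eventually.and (hW.mem_nhds hw) (eventually_ne_of_tendsto
      (hF.continuousOn.continuousAt (hW.mem_nhds hw)) (hfc w hw) hne))).exists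
  exact hxne (hFf x hxW hx)

theorem IsMProper.isBiholomorphism (hπ : IsMProper 2 D G π) (hD : IsDom D) (hG : IsOpen G)
    (Φ : OrbitSpace (Deck D π) ≃ₜ G)
    (hΦ : ∀ z : D, (Φ (OrbitSpace.proj (Deck D π) z) : Cn n) = π z) :
    OrbitSpace.IsBiholomorphism Φ := by
  intro W hW f
  set W' : Set (Cn n) := Subtype.val '' W with hW'
  have hW'o : IsOpen W' := hG.isOpenMap_subtype_val W hW
  have hW'G : W' ⊆ G := by rintro _ ⟨w, -, rfl⟩; exact w.2
  have hΦ' : ∀ z : D, Φ (OrbitSpace.proj (Deck D π) z) = ⟨π z, hπ.mapsTo z.2⟩ := fun z =>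
    Subtype.ext (hΦ z)
  have hmem : ∀ z : D, Φ (OrbitSpace.proj (Deck D π) z) ∈ W ↔ π z ∈ W' := fun z => by
    rw [hΦ']
    exact ⟨fun h => ⟨_, h, rfl⟩, by rintro ⟨w, hw, hwz⟩; convert hw; exact hwz.symm⟩
  have hpre : (Subtype.val '' (OrbitSpace.proj (Deck D π) ⁻¹' (Φ ⁻¹' W)) : Set (Cn n)) =
      D ∩ π ⁻¹' W' := by
    ext z
    constructor
    · rintro ⟨z, hz, rfl⟩
      exact ⟨z.2, (hmem z).1 hz⟩
    · rintro ⟨hz, hzW⟩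
      exact ⟨⟨z, hz⟩, (hmem ⟨z, hz⟩).2 hzW, rfl⟩
  constructor
  · rintro ⟨F, hF, hFf⟩
    refine ⟨F ∘ π, ?_, fun z hz => ?_⟩
    · rw [hpre]
      exact hF.comp (hπ.holomorphic.mono inter_subset_left) fun z hz => hz.2
    · rw [Function.comp_apply, Function.comp_apply, Function.comp_apply, ← hΦ]
      exact hFf _ hz
  · rintro ⟨H, hH, hHf⟩
    rw [hpre] at hH
    classical
    obtain ⟨F, hF, hFf⟩ := hπ.exists_differentiableOn_of_comp hD hG hW'o hW'G hH
      (f := fun w => if h : w ∈ G then f ⟨w, h⟩ else 0) (fun z hz hzW => by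
        rw [hHf ⟨z, hz⟩ ((hmem ⟨z, hz⟩).2 hzW), dif_pos (hπ.mapsTo hz)]
        exact congrArg f (hΦ' ⟨z, hz⟩))
    refine ⟨F, hF, fun w hw => ?_⟩
    rw [hFf w ⟨w, hw, rfl⟩, dif_pos w.2]

end ProperHol

theorem mainTheorem9 (n : ℕ) (D G : Set (ProperHol.Cn n)) (hD : ProperHol.IsDom D)
    (hG : ProperHol.IsDom G) (π : ProperHol.Cn n → ProperHol.Cn n)
    (hπ : ProperHol.IsMProper 2 D G π) :
    ∃ g : ProperHol.Aut D,
      g ≠ 1 ∧ g * g = 1 ∧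
      (∀ z : D, (z : ProperHol.Cn n) ∈ ProperHol.locus D π → g.1 z = z) ∧
      ProperHol.IsGaloisMap D G π ∧
      (ProperHol.Deck D π : Set (ProperHol.Aut D)) = {1, g} ∧
      ∃ Φ : ProperHol.OrbitSpace (ProperHol.Deck D π) ≃ₜ G,
        (∀ z : D, (Φ (ProperHol.OrbitSpace.proj (ProperHol.Deck D π) z) : ProperHol.Cn n) = π z) ∧
        ProperHol.OrbitSpace.IsBiholomorphism Φ := by
  obtain ⟨γ, hγ⟩ := hπ.exists_isSheetInvolution hD hG.1
  have hπp := hπ.toIsProperHolomorphic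
  let Φ : ProperHol.OrbitSpace (ProperHol.Deck D π) ≃ₜ G :=
    (Equiv.ofBijective hπp.quotientMap ⟨hγ.isGaloisMap.injective_quotientMap hπp,
      hπ.surjective_quotientMap hD.1 hG.1⟩).toHomeomorphOfContinuousClosed
      hπp.continuous_quotientMap (hπp.isClosedMap_quotientMap hG.1)
  exact ⟨hγ.aut, hγ.aut_ne_one hπ hD hG.1, hγ.aut_mul_self,
    fun z hz => Subtype.ext (hγ.eq_self_of_mem_locus hπ hD hG.1 hz), hγ.isGaloisMap,
    hγ.deck_eq hD, Φ, fun _ => rfl, hπ.isBiholomorphism hD hG.1 Φ fun _ => rfl⟩
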